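/- Let $L_2$ be the real Hilbert space of square-integrable signals $u:[0,\infty)\to\mathbb R$. For $T\ge 0$ let $P_Tu$ be the truncation of $u$ (equal to $u$ on $[0,T]$ and to $0$ afterwards), and let $L_{2e}$ be the space of signals $u:[0,\infty)\to\mathbb R$ with $P_Tu\in L_2$ for all $T\ge0$. Signals are identified when they agree almost everywhere. Let $R:L_{2e}\to L_{2e}$ be an LTI operator, that is, $R$ is linear and commutes with every time translation $(\sigma_Tu)(t)=u(t-T)$ for $t\ge T$, $(\sigma_Tu)(t)=0$ for $t<T$ ($T\ge0$). Let $R(s)$ be its transfer function: a meromorphic function on $\mathbb C$ (removable singularities removed) such that, for some $\sigma\ge 0$ and all $u\in L_2$, the Laplace transform of the output $y=Ru$ converges absolutely for $\operatorname{Re}s>\sigma$ and satisfies $Y(s)=R(s)U(s)$ there. Assume that $R$ is stable: every pole $p$ of $R(s)$ satisfies $\operatorname{Re}p<0$. If $R(s)$ is not a rational function, assume moreover that $R(s)$ is proper in the sense that it is bounded on $\{s:\operatorname{Re}s\ge0,\ |s|\ge\rho\}$ for some $\rho$. Let $\operatorname{dom}(R)=\{u\in L_2: Ru\in L_2\}$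 and define, with values in $[0,\infty]$, the incremental and non-incremental $L_2$-gains $$\Gamma(R)=\sup_{u_1\ne u_2\in\operatorname{dom}(R)}\frac{\|Ru_1-Ru_2\|}{\|u_1-u_2\|},\qquad \gamma(R)=\sup_{0\ne u\in\operatorname{dom}(R)}\frac{\|Ru\|}{\|u\|},$$ the scaled relative graph $$\operatorname{SRG}(R)=\Big\{\tfrac{\|Ru_1-Ru_2\|}{\|u_1-u_2\|}\,e^{\pm j\angle(u_1-u_2,\,Ru_1-Ru_2)} : u_1\neq u_2\in\operatorname{dom}(R)\Big\}\subseteq\mathbb C,$$ where $\angle(u,y)=\arccos\frac{\langle u,y\rangle}{\|u\|\|y\|}\in[0,\pi]$ (its value is immaterial if $y=0$), the Nyquist diagram $\operatorname{Nyquist}(R)=\{R(j\omega):\omega\in\mathbb R\}$, and the radius $r_{\min}(\mathcal C)=\inf\{r>0:\ |z|\le r\text{ for all }z\in\mathcal C\}\in[0,\infty]$ of a set $\mathcal C\subseteq\mathbb C$. Then $R$ is $L_2$-stable, i.e. $Ru\in L_2$ for every $u\in L_2$ (so $\operatorname{dom}(R)=L_2$), and $$r_{\min}(\operatorname{SRG}(R))=r_{\min}(\operatorname{Nyquist}(R))=\Gamma(R)=\gamma(R)=\|R\|_{H_\infty},\qquad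 \|R\|_{H_\infty}=\sup_{\operatorname{Re}s>0}|R(s)| .$$ -/

import Mathlib

open MeasureTheory Set Polynomial
open scoped ENNReal

noncomputable section

namespace SRG

/-! ### Signals -/

/-- Lebesgue measure on the time axis `[0, ∞)`. -/
abbrev timeMeasure : Measure ℝ := volume.restrict (Ici (0 : ℝ))

/-- The real Hilbert space `L₂` of square-integrable signals `[0, ∞) → ℝ`. -/
abbrev L2 : Type := Lp ℝ 2 timeMeasure

/-- The truncation `P_T u`, equal to `u` for `t ≤ T` and to `0` for `t > T`. -/
def trunc (T : ℝ) (u : ℝ → ℝ) : ℝ → ℝ := (Iic T).indicator u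

/-- The extended space `L₂ₑ`: (classes of) signals all of whose truncations `P_T u`, `T ≥ 0`, have
finite `L₂` norm. -/
def L2e : Submodule ℝ (ℝ →ₘ[timeMeasure] ℝ) where
  carrier := {u | ∀ T : ℝ, 0 ≤ T → MemLp (trunc T u) 2 timeMeasure}
  zero_mem' := by
    intro T _
    refine (MemLp.zero (ε := ℝ)).ae_eq ?_
    filter_upwards [AEEqFun.coeFn_zero (μ := timeMeasure) (α := ℝ) (β := ℝ)] with t ht
    by_cases h : t ∈ Iic T <;> simp [trunc, h, ht]
  add_mem' := by
    intro u v hu hv T hT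
    refine ((hu T hT).add (hv T hT)).ae_eq ?_
    filter_upwards [AEEqFun.coeFn_add u v] with t ht
    by_cases h : t ∈ Iic T <;> simp [trunc, h, ht]
  smul_mem' := by
    intro c u hu T hT
    refine ((hu T hT).const_smul c).ae_eq ?_
    filter_upwards [AEEqFun.coeFn_smul c u] with t ht
    by_cases h : t ∈ Iic T <;> simp [trunc, h, ht]

/-- The inclusion `L₂ ⊆ L₂ₑ`. -/
def L2.toL2e (u : L2) : L2e :=
  ⟨u.1, fun _ _ => (Lp.memLp u).indicator measurableSet_Iic⟩

/-- The delayed function: `u (t - T)` for `t ≥ T` and `0` otherwise. -/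
def delayFun (T : ℝ) (u : ℝ → ℝ) : ℝ → ℝ := (Ici T).indicator fun t => u (t - T)

lemma stronglyMeasurable_delayFun (T : ℝ) (u : ℝ →ₘ[timeMeasure] ℝ) :
    StronglyMeasurable (delayFun T u) :=
  (u.stronglyMeasurable.comp_measurable (measurable_id.sub_const T)).indicator measurableSet_Ici

lemma memLp_trunc_delayFun {u : ℝ →ₘ[timeMeasure] ℝ} (hu : u ∈ L2e) (S T : ℝ) :
    MemLp (trunc S (delayFun T u)) 2 timeMeasure := by
  have h1 : MemLp ((Ici (0 : ℝ)).indicator (trunc (max (S - T) 0) u)) 2 volume :=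
    (memLp_indicator_iff_restrict measurableSet_Ici).2 (hu _ (le_max_right _ _))
  have h2 := (h1.comp_measurePreserving (measurePreserving_sub_right volume T)).indicator
    (s := Iic S) measurableSet_Iic
  have h3 : trunc S (delayFun T u) = (Iic S).indicator
      ((Ici (0 : ℝ)).indicator (trunc (max (S - T) 0) u) ∘ fun t => t - T) := by
    funext t
    simp only [trunc, delayFun, indicator, mem_Iic, mem_Ici, Function.comp, sub_nonneg]
    by_cases hS : t ≤ S <;> by_cases hT : T ≤ t <;> simp [hS, hT]
  rw [h3]
  exact h2.restrict _

/-- The time translation operator `σ_T` on `L₂ₑ`. -/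
def delay (T : ℝ) (u : L2e) : L2e :=
  ⟨AEEqFun.mk (delayFun T u.1) (stronglyMeasurable_delayFun T u.1).aestronglyMeasurable, by
    intro S _
    refine (memLp_trunc_delayFun u.2 S T).ae_eq ?_
    filter_upwards [AEEqFun.coeFn_mk (delayFun T u.1)
      (stronglyMeasurable_delayFun T u.1).aestronglyMeasurable] with t ht
    by_cases h : t ∈ Iic S <;> simp [trunc, h, ht]⟩

/-! ### LTI systems and transfer functions -/

/-- A system `R : L₂ₑ → L₂ₑ` is LTI if it is linear and commutes with all time translations. -/
structure IsLTI (R : L2e → L2e) : Prop where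
  linear : IsLinearMap ℝ R
  timeInvariant : ∀ T : ℝ, 0 ≤ T → ∀ u : L2e, R (delay T u) = delay T (R u)

/-- The Laplace transform `∫₀^∞ e^{-st} u(t) dt`. -/
def laplace (u : ℝ → ℝ) (s : ℂ) : ℂ := ∫ t, Complex.exp (-s * t) * (u t : ℂ) ∂timeMeasure

/-- `G` represents the system `R` in the Laplace domain: on some right half-plane the output
`y = R u` of every input `u ∈ L₂` has an absolutely convergent Laplace transform, and
`Y(s) = G(s) U(s)`. (The Laplace transform of `u ∈ L₂` converges absolutely for `Re s > 0`.) -/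
def Represents (G : ℂ → ℂ) (R : L2e → L2e) : Prop :=
  ∃ σ : ℝ, 0 ≤ σ ∧ ∀ (u : L2) (s : ℂ), σ < s.re →
    Integrable (fun t : ℝ => Complex.exp (-s * t) * (((R u.toL2e).1 t : ℝ) : ℂ)) timeMeasure ∧
    laplace (R u.toL2e).1 s = G s * laplace u s

/-- `G` is a transfer function of `R`: it represents `R`, and it is meromorphic on the plane, where
removable singularities have been removed. -/
structure IsTransferFunction (G : ℂ → ℂ) (R : L2e → L2e) : Prop where
  meromorphic : MeromorphicNFOn G univ
  represents : Represents G R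

/-- `p` is a pole of `G`. -/
def IsPole (G : ℂ → ℂ) (p : ℂ) : Prop := meromorphicOrderAt G p < 0

/-- `G` is a quotient of two polynomials. -/
def IsRational (G : ℂ → ℂ) : Prop :=
  ∃ a b : ℂ[X], a ≠ 0 ∧ ∀ s : ℂ, a.eval s ≠ 0 → G s = b.eval s / a.eval s

/-- `G` stays bounded as `|s| → ∞` in the closed right half-plane. For a rational `G` this says that
the degree of the numerator is at most that of the denominator. -/
def IsProper (G : ℂ → ℂ) : Prop :=
  ∃ ρ M : ℝ, ∀ s : ℂ, 0 ≤ s.re → ρ ≤ ‖s‖ → ‖G s‖ ≤ M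

/-- The Nyquist diagram `{G(jω) | ω ∈ ℝ}`. -/
def nyquist (G : ℂ → ℂ) : Set ℂ := range fun ω : ℝ => G (Complex.I * ω)

/-- The `H_∞` norm: the supremum of `|G|` over the open right half-plane. -/
def hInfNorm (G : ℂ → ℂ) : ℝ≥0∞ := ⨆ (s : ℂ) (_ : 0 < s.re), ENNReal.ofReal ‖G s‖

/-! ### Operators on a Hilbert space: gains and scaled relative graph -/

/-- The radius of a set: the infimum of all `r > 0` such that the set lies in the closed disk of
radius `r` about `0` (and `∞` if there is none). -/
def radius (C : Set ℂ) : ℝ≥0∞ :=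
  ⨅ (r : ℝ) (_ : 0 < r) (_ : C ⊆ Metric.closedBall 0 r), ENNReal.ofReal r

section Operators

variable {H : Type*} [NormedAddCommGroup H] [InnerProductSpace ℝ H] {D : Set H}

/-- The scaled relative graph of an operator `R : D ⊆ H → H`: all numbers
`‖y₁ - y₂‖ / ‖u₁ - u₂‖ * e^{± j ∠(u₁ - u₂, y₁ - y₂)}` with `u₁ ≠ u₂` in `D` and `yᵢ = R uᵢ`. -/
def srg (R : D → H) : Set ℂ :=
  {z | ∃ u₁ u₂ : D, u₁ ≠ u₂ ∧ ∃ θ : ℝ,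
    (θ = InnerProductGeometry.angle ((u₁ : H) - u₂) (R u₁ - R u₂) ∨
      θ = -InnerProductGeometry.angle ((u₁ : H) - u₂) (R u₁ - R u₂)) ∧
    z = ((‖R u₁ - R u₂‖ / ‖(u₁ : H) - u₂‖ : ℝ) : ℂ) * Complex.exp (Complex.I * θ)}

/-- The incremental gain `Γ(R)`. -/
def incGain (R : D → H) : ℝ≥0∞ :=
  ⨆ (u₁ : D) (u₂ : D) (_ : u₁ ≠ u₂), ENNReal.ofReal (‖R u₁ - R u₂‖ / ‖(u₁ : H) - u₂‖)

/-- The non-incremental gain `γ(R)`. -/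
def gain (R : D → H) : ℝ≥0∞ :=
  ⨆ (u : D) (_ : (u : H) ≠ 0), ENNReal.ofReal (‖R u‖ / ‖(u : H)‖)

end Operators

/-- The domain of a system as an operator on `L₂`: all inputs in `L₂` whose output is in `L₂`. -/
def domL2 (R : L2e → L2e) : Set L2 := {u | (R u.toL2e).1 ∈ Lp ℝ 2 timeMeasure}

/-- A system as an operator `dom(R) ⊆ L₂ → L₂`. -/
def onL2 (R : L2e → L2e) (u : domL2 R) : L2 := ⟨(R u.1.toL2e).1, u.2⟩

/-- A system is `L₂`-stable if it maps `L₂` into `L₂`. -/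
def IsL2Stable (R : L2e → L2e) : Prop := domL2 R = univ

end SRG

end

namespace SRG

/-! ### Fourier analysis on the line -/

section Fourier

open FourierTransform SchwartzMap
open scoped Real

/-! Stability and normal form make `G` analytic on the closed right half-plane, and properness with
compactness makes it bounded there. A rational `G` is automatically proper: otherwise the response
to `e^{-t}` would have a Laplace transform that does not tend to `0` along the real axis.

Gain at most the `H_∞` norm (`exists_clm_of_represents`): let `M` bound `|G|`, and let `U` be
`O(|s|⁻²)`. Then `GU` is integrable on vertical lines. Fourier inversion recovers the damped output
`e^{-xt} y` on one line far to the right, and Cauchy's theorem carries the formula to every `x > 0`.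
Plancherel bounds the damped output by `M ‖u‖`, and `x → 0` gives `‖y‖ ≤ M ‖u‖`. Such inputs are
dense (`dense_decaySpace`), so `R` restricted to them extends to a bounded `T`. `T` agrees with `R`
on all of `L₂` because both outputs have transform `GU` far to the right.

`H_∞` norm at most the gain (`norm_le_of_laplace_eq_mul`): evaluating the Laplace transform at `s`
is pairing with the kernel `e^{-s̄t}`, an eigenvector of the adjoint of `T` (complexified) with
eigenvalue the conjugate of `G(s)`. Hence `|G(s)| ≤ ‖T‖`.

Phragmén–Lindelöf moves the supremum of `|G|` to the imaginary axis. Points of the scaled relative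
graph have the incremental quotients as moduli, and linearity identifies the two gains. -/

theorem ae_eq_of_integral_schwartz_smul_eq {f g : ℝ → ℂ} (hf : LocallyIntegrable f)
    (hg : LocallyIntegrable g) (h : ∀ φ : 𝓢(ℝ, ℂ), ∫ x, φ x • f x = ∫ x, φ x • g x) :
    f =ᵐ[volume] g := by
  have key : ∀ᵐ x, (f - g) x = 0 := by
    refine ae_eq_zero_of_integral_contDiff_smul_eq_zero (hf.sub hg) fun φ hφ hc => ?_
    have hc' : HasCompactSupport (Complex.ofRealCLM ∘ φ) := hc.comp_left rfl
    have hφ' : ContDiff ℝ _ (Complex.ofRealCLM ∘ φ) := Complex.ofRealCLM.contDiff.comp hφ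
    have := h (hc'.toSchwartzMap hφ')
    have hi : ∀ {u : ℝ → ℂ}, LocallyIntegrable u → Integrable fun x => φ x • u x := fun hu =>
      hu.integrable_smul_left_of_hasCompactSupport hφ.continuous hc
    simp only [Pi.sub_apply, smul_sub]
    rw [integral_sub (hi hf) (hi hg), sub_eq_zero]
    simpa using this
  filter_upwards [key] with x hx
  exact sub_eq_zero.1 hx

theorem integral_fourier_smul_eq {f g : ℝ → ℂ} (hf : Integrable f) (hg : Integrable g) :
    ∫ x, 𝓕 f x • g x = ∫ x, f x • 𝓕 g x := by
  simpa using! VectorFourier.integral_fourierIntegral_smul_eq_flip (L := innerₗ ℝ)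
    Real.continuous_fourierChar continuous_inner hf hg

theorem integral_fourierInv_smul_eq {f g : ℝ → ℂ} (hf : Integrable f) (hg : Integrable g) :
    ∫ x, 𝓕⁻ f x • g x = ∫ x, f x • 𝓕⁻ g x := by
  rw [Real.fourierInv_eq_fourier_comp_neg, Real.fourierInv_eq_fourier_comp_neg,
    integral_fourier_smul_eq hf.comp_neg hg, ← integral_neg_eq_self]
  simp only [neg_neg, ← Real.fourierInv_eq_fourier_neg]
  simp only [Real.fourierInv_eq_fourier_comp_neg]

theorem continuous_fourier {f : ℝ → ℂ} (hf : Integrable f) : Continuous (𝓕 f) :=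
  VectorFourier.fourierIntegral_continuous Real.continuous_fourierChar
    (by exact continuous_inner) hf

/-- Links the abstract Fourier transform on `L²` with the integral formula: both pair equally with
every Schwartz function, since the transform can be moved onto the test function. -/
theorem coeFn_fourier_toLp {f : ℝ → ℂ} (hf : Integrable f) (hf2 : MemLp f 2) :
    (𝓕 (hf2.toLp f) : Lp ℂ 2 (volume : Measure ℝ)) =ᵐ[volume] 𝓕 f := by
  refine ae_eq_of_integral_schwartz_smul_eq
    ((Lp.memLp _).locallyIntegrable (by norm_num)) (continuous_fourier hf).locallyIntegrable
    fun φ => ?_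
  have h1 := congrArg (fun T : 𝓢'(ℝ, ℂ) => T φ)
    (Lp.fourier_toTemperedDistribution_eq (hf2.toLp f))
  simp only [TemperedDistribution.fourier_apply, Lp.toTemperedDistribution_apply] at h1
  rw [← h1, ← integral_fourier_smul_eq φ.integrable hf, ← SchwartzMap.fourier_coe]
  refine integral_congr_ae ?_
  filter_upwards [hf2.coeFn_toLp] with x hx
  rw [hx]

/-- Plancherel's theorem for integrable square-integrable functions. -/
theorem eLpNorm_fourier {f : ℝ → ℂ} (hf : Integrable f) (hf2 : MemLp f 2) :
    eLpNorm (𝓕 f) 2 volume = eLpNorm f 2 volume := by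
  rw [← eLpNorm_congr_ae (coeFn_fourier_toLp hf hf2), ← eLpNorm_congr_ae hf2.coeFn_toLp,
    ← Lp.enorm_def, ← Lp.enorm_def, ← ofReal_norm, ← ofReal_norm, Lp.norm_fourier_eq]

theorem eLpNorm_fourierInv {f : ℝ → ℂ} (hf : Integrable f) (hf2 : MemLp f 2) :
    eLpNorm (𝓕⁻ f) 2 volume = eLpNorm f 2 volume := by
  have hneg : MeasurePreserving (fun x : ℝ => -x) volume volume :=
    Measure.measurePreserving_neg _
  rw [Real.fourierInv_eq_fourier_comp_neg,
    eLpNorm_fourier hf.comp_neg (hf2.comp_measurePreserving hneg)]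
  exact eLpNorm_comp_measurePreserving hf2.aestronglyMeasurable hneg

theorem continuous_fourierInv {f : ℝ → ℂ} (hf : Integrable f) : Continuous (𝓕⁻ f) := by
  rw [Real.fourierInv_eq_fourier_comp_neg]
  exact continuous_fourier hf.comp_neg

/-- Fourier inversion almost everywhere, for an integrable function with integrable transform. -/
theorem ae_eq_fourierInv_fourier {f : ℝ → ℂ} (hf : Integrable f) (hf' : Integrable (𝓕 f)) :
    f =ᵐ[volume] 𝓕⁻ (𝓕 f) := by
  refine ae_eq_of_integral_schwartz_smul_eq hf.locallyIntegrable
    (continuous_fourierInv hf').locallyIntegrable fun φ => ?_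
  rw [← integral_fourierInv_smul_eq φ.integrable hf', ← SchwartzMap.fourierInv_coe,
    ← integral_fourier_smul_eq (𝓕⁻ φ).integrable hf, ← SchwartzMap.fourier_coe,
    FourierTransform.fourier_fourierInv_eq]

/-- Every Schwartz function is the transform of another one, so pairings with `f` and `g` are
pairings with their transforms. -/
theorem ae_eq_of_fourier_eq {f g : ℝ → ℂ} (hf : Integrable f) (hg : Integrable g)
    (h : 𝓕 f = 𝓕 g) : f =ᵐ[volume] g := by
  refine ae_eq_of_integral_schwartz_smul_eq hf.locallyIntegrable hg.locallyIntegrable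
    fun φ => ?_
  obtain ⟨ψ, rfl⟩ : ∃ ψ : 𝓢(ℝ, ℂ), φ = 𝓕 ψ :=
    ⟨𝓕⁻ φ, (FourierTransform.fourier_fourierInv_eq φ).symm⟩
  rw [SchwartzMap.fourier_coe, integral_fourier_smul_eq ψ.integrable hf,
    integral_fourier_smul_eq ψ.integrable hg, h]

end Fourier

/-! ### The Laplace transform -/

section Laplace

open FourierTransform Filter Topology
open scoped Real

/-- The causal complex signal `e^{-xt} u(t)`, extended by zero to negative times. -/
noncomputable def damped (u : ℝ → ℝ) (x : ℝ) : ℝ → ℂ :=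
  (Ici (0 : ℝ)).indicator fun t => Complex.exp (-(x : ℂ) * t) * (u t : ℂ)

theorem norm_exp_neg_mul (s : ℂ) (t : ℝ) : ‖Complex.exp (-s * t)‖ = Real.exp (-s.re * t) := by
  simp [Complex.norm_exp]

theorem integrable_exp_mul_iff {u : ℝ → ℝ} (hu : AEStronglyMeasurable u timeMeasure) (s : ℂ) :
    Integrable (fun t : ℝ => Complex.exp (-s * t) * (u t : ℂ)) timeMeasure ↔
      Integrable (fun t : ℝ => Real.exp (-s.re * t) * u t) timeMeasure := by
  have h1 : AEStronglyMeasurable (fun t : ℝ => Complex.exp (-s * t) * (u t : ℂ)) timeMeasure :=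
    (by fun_prop : Continuous fun t : ℝ => Complex.exp (-s * t)).aestronglyMeasurable.mul
      (Complex.continuous_ofReal.comp_aestronglyMeasurable hu)
  have h2 : AEStronglyMeasurable (fun t : ℝ => Real.exp (-s.re * t) * u t) timeMeasure :=
    (by fun_prop : Continuous fun t : ℝ => Real.exp (-s.re * t)).aestronglyMeasurable.mul hu
  rw [← integrable_norm_iff h1, ← integrable_norm_iff h2]
  simp only [norm_mul, norm_exp_neg_mul, Complex.norm_real, Real.norm_eq_abs, Real.abs_exp]

theorem integrable_damped_iff {u : ℝ → ℝ} {x : ℝ} : Integrable (damped u x) ↔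
    Integrable (fun t : ℝ => Complex.exp (-(x : ℂ) * t) * (u t : ℂ)) timeMeasure :=
  integrable_indicator_iff measurableSet_Ici

/-- The ordinate `2πξ` matches the kernel `e^{-2πitξ}`, so Plancherel on a vertical line carries no
constant. -/
theorem laplace_eq_fourier (u : ℝ → ℝ) (x ξ : ℝ) :
    laplace u (x + 2 * π * ξ * Complex.I) = 𝓕 (damped u x) ξ := by
  rw [Real.fourier_real_eq_integral_exp_smul, laplace, damped,
    ← integral_indicator measurableSet_Ici]
  congr 1 with t
  by_cases ht : t ∈ Ici (0 : ℝ)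
  · simp only [indicator_of_mem ht, smul_eq_mul, ← mul_assoc, ← Complex.exp_add]
    congr 2
    push_cast
    ring
  · simp [indicator_of_notMem ht]

/-- Lets part of an exponential absorb a factor `t`. -/
theorem mul_exp_neg_le {x : ℝ} (hx : 0 < x) (t : ℝ) : t * Real.exp (-x * t) ≤ 1 / x := by
  have h1 : x * t ≤ Real.exp (x * t) := by linarith [Real.add_one_le_exp (x * t)]
  have h2 : Real.exp (-x * t) * Real.exp (x * t) = 1 := by
    rw [← Real.exp_add]; simp
  rw [le_div_iff₀ hx]
  nlinarith [Real.exp_pos (-x * t)]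

theorem memLp_exp_neg {x : ℝ} (hx : 0 < x) :
    MemLp (fun t : ℝ => Real.exp (-x * t)) 2 timeMeasure := by
  rw [memLp_two_iff_integrable_sq (by fun_prop)]
  have h := (integrableOn_Ici_iff_integrableOn_Ioi).2
    (integrableOn_exp_mul_Ioi (a := -(2 * x)) (by linarith) 0)
  refine h.congr (ae_of_all _ fun t => ?_)
  simp only [← Real.exp_nat_mul]
  congr 1
  push_cast
  ring

theorem integrable_exp_mul_L2 {u : ℝ → ℝ} (hu : MemLp u 2 timeMeasure) {s : ℂ} (hs : 0 < s.re) :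
    Integrable (fun t : ℝ => Complex.exp (-s * t) * (u t : ℂ)) timeMeasure :=
  (integrable_exp_mul_iff hu.aestronglyMeasurable s).2 ((memLp_exp_neg hs).integrable_mul hu)

theorem laplace_add {u v : ℝ → ℝ} (hu : MemLp u 2 timeMeasure) (hv : MemLp v 2 timeMeasure)
    {s : ℂ} (hs : 0 < s.re) : laplace (u + v) s = laplace u s + laplace v s := by
  rw [laplace, laplace, laplace,
    ← integral_add (integrable_exp_mul_L2 hu hs) (integrable_exp_mul_L2 hv hs)]
  simp [mul_add]

theorem laplace_smul (c : ℝ) (u : ℝ → ℝ) (s : ℂ) : laplace (c • u) s = c * laplace u s := by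
  rw [laplace, laplace, ← integral_const_mul]
  congr 1 with t
  simp only [Pi.smul_apply, smul_eq_mul, Complex.ofReal_mul]
  ring

theorem laplace_congr {u v : ℝ → ℝ} (h : u =ᵐ[timeMeasure] v) (s : ℂ) :
    laplace u s = laplace v s := by
  refine integral_congr_ae ?_
  filter_upwards [h] with t ht
  rw [ht]

/-- Evaluation of the Laplace transform at a point of the right half-plane is a bounded linear
functional on `L₂`. -/
theorem exists_norm_laplace_le {s : ℂ} (hs : 0 < s.re) :
    ∃ K : ℝ, ∀ u : L2, ‖laplace u s‖ ≤ K * ‖u‖ := by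
  set e : L2 := (memLp_exp_neg hs).toLp _
  refine ⟨‖e‖, fun u => ?_⟩
  calc ‖laplace u s‖ ≤ ∫ t, ‖Complex.exp (-s * t) * (u t : ℂ)‖ ∂timeMeasure :=
        norm_integral_le_integral_norm _
    _ = inner ℝ e |u| := by
        rw [L2.inner_def]
        refine integral_congr_ae ?_
        filter_upwards [(memLp_exp_neg hs).coeFn_toLp, Lp.coeFn_abs u] with t h1 h2
        rw [h1, h2, norm_mul, norm_exp_neg_mul, Complex.norm_real, Real.norm_eq_abs]
        simp [mul_comm]
    _ ≤ ‖e‖ * ‖u‖ := (real_inner_le_norm _ _).trans_eq (by rw [norm_abs_eq_norm])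

theorem differentiableOn_laplace {u : ℝ → ℝ} (hu : MemLp u 2 timeMeasure) :
    DifferentiableOn ℂ (laplace u) {s | 0 < s.re} := by
  intro s₀ (hs₀ : 0 < s₀.re)
  set x := s₀.re
  have hmeas : ∀ s : ℂ, AEStronglyMeasurable
      (fun t : ℝ => Complex.exp (-s * t) * (u t : ℂ)) timeMeasure := fun s =>
    (by fun_prop : Continuous fun t : ℝ => Complex.exp (-s * t)).aestronglyMeasurable.mul
      (Complex.continuous_ofReal.comp_aestronglyMeasurable hu.aestronglyMeasurable)
  -- Near `s₀` the decay is at least `e^{-xt/2}`. One half of the exponent absorbs the factor `t` at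
  -- the cost of `4 / x`; the other half is square-integrable and pairs with `u`.
  have hbound : Integrable (fun t => 4 / x * ‖Real.exp (-(x / 4) * t) * u t‖) timeMeasure :=
    (((memLp_exp_neg (by positivity : 0 < x / 4)).integrable_mul hu).norm).const_mul _
  have hnhds : {s : ℂ | x / 2 < s.re} ∈ 𝓝 s₀ :=
    (isOpen_lt continuous_const Complex.continuous_re).mem_nhds (half_lt_self hs₀)
  refine DifferentiableAt.differentiableWithinAt ?_
  refine (hasDerivAt_integral_of_dominated_loc_of_deriv_le (𝕜 := ℂ) hnhds
    (F := fun (s : ℂ) (t : ℝ) => Complex.exp (-s * t) * (u t : ℂ))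
    (F' := fun (s : ℂ) (t : ℝ) => -(t : ℂ) * (Complex.exp (-s * t) * (u t : ℂ)))
    (Eventually.of_forall hmeas) (integrable_exp_mul_L2 hu hs₀)
    ((by fun_prop : Continuous fun t : ℝ => -(t : ℂ)).aestronglyMeasurable.mul (hmeas s₀))
    ?_ hbound ?_).2.differentiableAt
  · filter_upwards [ae_restrict_mem measurableSet_Ici] with t (ht : 0 ≤ t) s (hs : x / 2 < s.re)
    rw [norm_mul, norm_mul, norm_exp_neg_mul, norm_neg, Complex.norm_real, Complex.norm_real,
      norm_mul, Real.norm_of_nonneg ht, Real.norm_of_nonneg (Real.exp_pos _).le]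
    have h1 : Real.exp (-s.re * t) ≤ Real.exp (-(x / 4) * t) * Real.exp (-(x / 4) * t) := by
      rw [← Real.exp_add]
      exact Real.exp_le_exp.2 (by nlinarith)
    have h2 : t * Real.exp (-(x / 4) * t) ≤ 4 / x :=
      (mul_exp_neg_le (by positivity) t).trans_eq (by rw [one_div_div])
    calc t * (Real.exp (-s.re * t) * ‖u t‖)
        ≤ t * ((Real.exp (-(x / 4) * t) * Real.exp (-(x / 4) * t)) * ‖u t‖) := by gcongr
      _ = (t * Real.exp (-(x / 4) * t)) * (Real.exp (-(x / 4) * t) * ‖u t‖) := by ring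
      _ ≤ 4 / x * (Real.exp (-(x / 4) * t) * ‖u t‖) := by gcongr
  · refine ae_of_all _ fun t s _ => ?_
    have h : HasDerivAt (fun s : ℂ => -s * (t : ℂ)) (-(t : ℂ)) s := by
      simpa using ((hasDerivAt_id s).neg.mul_const (t : ℂ))
    exact (h.cexp.mul_const (u t : ℂ)).congr_deriv (by ring)

theorem norm_damped_le {u : ℝ → ℝ} {x : ℝ} (hx : 0 ≤ x) (t : ℝ) :
    ‖damped u x t‖ ≤ ‖(Ici (0 : ℝ)).indicator u t‖ := by
  by_cases ht : t ∈ Ici (0 : ℝ)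
  · simp only [damped, indicator_of_mem ht, norm_mul, Complex.norm_real, norm_exp_neg_mul,
      Complex.ofReal_re]
    refine mul_le_of_le_one_left (norm_nonneg _) (Real.exp_le_one_iff.2 ?_)
    nlinarith [mem_Ici.1 ht]
  · simp [damped, indicator_of_notMem ht]

theorem aestronglyMeasurable_damped {u : ℝ → ℝ} (hu : AEStronglyMeasurable u timeMeasure) (x : ℝ) :
    AEStronglyMeasurable (damped u x) volume := by
  rw [damped, aestronglyMeasurable_indicator_iff measurableSet_Ici]
  exact (by fun_prop : Continuous fun t : ℝ => Complex.exp (-(x : ℂ) * t)).aestronglyMeasurable.mul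
      (Complex.continuous_ofReal.comp_aestronglyMeasurable hu)

theorem memLp_damped {u : ℝ → ℝ} (hu : MemLp u 2 timeMeasure) {x : ℝ} (hx : 0 ≤ x) :
    MemLp (damped u x) 2 volume :=
  ((memLp_indicator_iff_restrict measurableSet_Ici).2 hu).of_le
    (aestronglyMeasurable_damped hu.aestronglyMeasurable x) (ae_of_all _ (norm_damped_le hx))

theorem eLpNorm_damped_le {u : ℝ → ℝ} {x : ℝ} (hx : 0 ≤ x) :
    eLpNorm (damped u x) 2 volume ≤ eLpNorm u 2 timeMeasure := by
  rw [← eLpNorm_indicator_eq_eLpNorm_restrict measurableSet_Ici]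
  exact eLpNorm_mono (norm_damped_le hx)

theorem integrable_damped {u : ℝ → ℝ} (hu : MemLp u 2 timeMeasure) {x : ℝ} (hx : 0 < x) :
    Integrable (damped u x) :=
  integrable_damped_iff.2 (integrable_exp_mul_L2 hu (by simpa using hx))

/-- A signal is determined by its Laplace transform on a vertical line. -/
theorem ae_eq_of_laplace_eq {u v : ℝ → ℝ} {x : ℝ} (hu : Integrable (damped u x))
    (hv : Integrable (damped v x))
    (h : ∀ ξ : ℝ, laplace u (x + 2 * π * ξ * Complex.I) = laplace v (x + 2 * π * ξ * Complex.I)) :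
    u =ᵐ[timeMeasure] v := by
  have key := ae_eq_of_fourier_eq hu hv (funext fun ξ => by
    rw [← laplace_eq_fourier, ← laplace_eq_fourier, h])
  filter_upwards [ae_restrict_of_ae key, ae_restrict_mem measurableSet_Ici] with t h1 h2
  simpa [damped, indicator_of_mem h2, Complex.exp_ne_zero] using h1

/-- If the damped signals are bounded in `L₂`, uniformly in the damping, so is the signal. -/
theorem eLpNorm_le_of_damped {y : ℝ → ℝ} (hy : AEStronglyMeasurable y timeMeasure) {B : ℝ≥0∞}
    (h : ∀ x : ℝ, 0 < x → eLpNorm (damped y x) 2 volume ≤ B) :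
    eLpNorm y 2 timeMeasure ≤ B := by
  have hlim : ∀ t, Tendsto (fun n : ℕ => damped y (1 / ((n : ℝ) + 1)) t) atTop
      (𝓝 (damped y 0 t)) := fun t => by
    have hcont : Continuous fun x : ℝ => damped y x t := by
      by_cases ht : t ∈ Ici (0 : ℝ)
      · simp only [damped, indicator_of_mem ht]
        fun_prop
      · simp only [damped, indicator_of_notMem ht]
        fun_prop
    exact (hcont.tendsto 0).comp tendsto_one_div_add_atTop_nhds_zero_nat
  -- Fatou's lemma along the dampings `1 / (n + 1)`.
  have h0 := Lp.eLpNorm_lim_le_liminf_eLpNorm (p := 2) (μ := volume)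
    (fun n : ℕ => aestronglyMeasurable_damped hy (1 / ((n : ℝ) + 1))) (damped y 0)
    (ae_of_all _ hlim)
  have h1 : eLpNorm y 2 timeMeasure = eLpNorm (damped y 0) 2 volume := by
    rw [← eLpNorm_indicator_eq_eLpNorm_restrict measurableSet_Ici]
    refine eLpNorm_congr_norm_ae (ae_of_all _ fun t => ?_)
    by_cases ht : t ∈ Ici (0 : ℝ) <;> simp [damped, ht]
  rw [h1]
  refine h0.trans (liminf_le_of_le (by isBoundedDefault) fun b hb => ?_)
  obtain ⟨n, hn⟩ := hb.exists
  exact hn.trans (h _ (by positivity))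

end Laplace

/-! ### A dense space of signals with rapidly decaying Laplace transform -/

section DecaySpace

open Filter Topology
open scoped Real ComplexConjugate

theorem norm_mul_exp_neg_le {z : ℂ} (hz : 0 < z.re) {t : ℝ} (ht : 0 ≤ t) :
    ‖(t : ℂ) * Complex.exp (-z * t)‖ ≤ 2 / z.re * Real.exp (-(z.re / 2) * t) := by
  rw [norm_mul, norm_exp_neg_mul, Complex.norm_real, Real.norm_of_nonneg ht]
  have h1 : Real.exp (-z.re * t) = Real.exp (-(z.re / 2) * t) * Real.exp (-(z.re / 2) * t) := by
    rw [← Real.exp_add]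
    congr 1
    ring
  rw [h1, ← mul_assoc]
  gcongr
  exact (mul_exp_neg_le (by positivity) t).trans_eq (by rw [one_div_div])

theorem integrable_mul_exp_neg {z : ℂ} (hz : 0 < z.re) :
    Integrable (fun t : ℝ => (t : ℂ) * Complex.exp (-z * t)) timeMeasure := by
  have h : IntegrableOn (fun t : ℝ => Real.exp (-(z.re / 2) * t)) (Ici 0) :=
    (integrableOn_Ici_iff_integrableOn_Ioi).2 (integrableOn_exp_mul_Ioi (by linarith) 0)
  refine (h.const_mul (2 / z.re)).mono' (by fun_prop) ?_
  filter_upwards [ae_restrict_mem measurableSet_Ici] with t ht using norm_mul_exp_neg_le hz ht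

theorem integral_mul_exp_neg {z : ℂ} (hz : 0 < z.re) :
    ∫ t : ℝ, (t : ℂ) * Complex.exp (-z * t) ∂timeMeasure = 1 / z ^ 2 := by
  have hz0 : z ≠ 0 := fun h => by simp [h] at hz
  have hderiv : ∀ t ∈ Ici (0 : ℝ), HasDerivAt
      (fun t : ℝ => -((t : ℂ) / z + 1 / z ^ 2) * Complex.exp (-z * t))
      ((t : ℂ) * Complex.exp (-z * t)) t := fun t _ => by
    have h1 : HasDerivAt (fun t : ℝ => (t : ℂ)) 1 t := Complex.ofRealCLM.hasDerivAt
    have h2 := (((h1.div_const z).add_const (1 / z ^ 2)).neg).mul ((h1.const_mul (-z)).cexp)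
    refine h2.congr_deriv ?_
    simp only [Pi.neg_apply]
    field_simp
    ring
  have hlim : Tendsto (fun t : ℝ => -((t : ℂ) / z + 1 / z ^ 2) * Complex.exp (-z * t)) atTop
      (𝓝 0) := by
    have h1 : Tendsto (fun t : ℝ => Real.exp (-z.re * t)) atTop (𝓝 0) := by
      simpa using tendsto_rpow_mul_exp_neg_mul_atTop_nhds_zero 0 z.re hz
    have h2 : Tendsto (fun t : ℝ => t * Real.exp (-z.re * t)) atTop (𝓝 0) := by
      simpa using tendsto_rpow_mul_exp_neg_mul_atTop_nhds_zero 1 z.re hz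
    refine squeeze_zero_norm' (a := fun t : ℝ => ‖z‖⁻¹ * (t * Real.exp (-z.re * t)) +
      ‖1 / z ^ 2‖ * Real.exp (-z.re * t)) ?_ ?_
    · filter_upwards [eventually_ge_atTop 0] with t ht
      rw [norm_mul, norm_exp_neg_mul, norm_neg]
      calc ‖(t : ℂ) / z + 1 / z ^ 2‖ * Real.exp (-z.re * t)
          ≤ (‖(t : ℂ) / z‖ + ‖1 / z ^ 2‖) * Real.exp (-z.re * t) := by
            gcongr
            exact norm_add_le _ _
        _ = _ := by
            rw [norm_div, Complex.norm_real, Real.norm_of_nonneg ht]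
            ring
    · simpa using (h2.const_mul _).add (h1.const_mul _)
  rw [integral_Ici_eq_integral_Ioi, integral_Ioi_of_hasDerivAt_of_tendsto' hderiv
    ((integrable_mul_exp_neg hz).mono_measure (Measure.restrict_mono Ioi_subset_Ici_self le_rfl))
    hlim]
  simp

/-- The square-integrable signals whose Laplace transform is `O(|s|⁻²)` in the right half-plane. -/
def decaySpace : Submodule ℝ L2 where
  carrier := {u | ∃ C : ℝ, ∀ s : ℂ, 0 < s.re → ‖laplace u s‖ ≤ C / (1 + ‖s‖ ^ 2)}
  zero_mem' := ⟨0, fun s _ => by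
    rw [laplace_congr (Lp.coeFn_zero ℝ 2 timeMeasure)]
    simp [laplace]⟩
  add_mem' := by
    rintro u v ⟨C, hC⟩ ⟨D, hD⟩
    refine ⟨C + D, fun s hs => ?_⟩
    rw [laplace_congr (Lp.coeFn_add u v), laplace_add (Lp.memLp u) (Lp.memLp v) hs, add_div]
    exact (norm_add_le _ _).trans (add_le_add (hC s hs) (hD s hs))
  smul_mem' := by
    rintro c u ⟨C, hC⟩
    refine ⟨|c| * C, fun s hs => ?_⟩
    rw [laplace_congr (Lp.coeFn_smul c u), laplace_smul, norm_mul, Complex.norm_real, mul_div_assoc]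
    exact mul_le_mul_of_nonneg_left (hC s hs) (abs_nonneg c)

/-- The signal `Re (c t e^{-at})`. -/
noncomputable def rampExp (c a : ℂ) (t : ℝ) : ℝ := (c * ((t : ℂ) * Complex.exp (-a * t))).re

theorem memLp_rampExp (c : ℂ) {a : ℂ} (ha : 0 < a.re) : MemLp (rampExp c a) 2 timeMeasure := by
  refine ((memLp_exp_neg (half_pos ha)).const_mul (‖c‖ * (2 / a.re))).of_le
    (Continuous.aestronglyMeasurable (by unfold rampExp; fun_prop)) ?_
  filter_upwards [ae_restrict_mem measurableSet_Ici] with t ht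
  rw [Real.norm_of_nonneg (by positivity : 0 ≤ ‖c‖ * (2 / a.re) * Real.exp (-(a.re / 2) * t))]
  calc ‖rampExp c a t‖ ≤ ‖c * ((t : ℂ) * Complex.exp (-a * t))‖ := Complex.abs_re_le_norm _
    _ ≤ ‖c‖ * (2 / a.re * Real.exp (-(a.re / 2) * t)) := by
        rw [norm_mul]
        gcongr
        exact norm_mul_exp_neg_le ha ht
    _ = _ := by ring

/-- Taking the real part averages the transform with its conjugate partner. The factor `t` produces
double poles, hence the decay `O(|s|⁻²)`. -/
theorem laplace_rampExp (c : ℂ) {a s : ℂ} (ha : 0 < a.re) (hs : 0 < s.re) :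
    laplace (rampExp c a) s = (c / (s + a) ^ 2 + conj c / (s + conj a) ^ 2) / 2 := by
  have h1 : 0 < (s + a).re := by simpa using add_pos hs ha
  have h2 : 0 < (s + conj a).re := by simpa using add_pos hs ha
  have key : ∀ t : ℝ, Complex.exp (-s * t) * (rampExp c a t : ℂ) =
      c / 2 * ((t : ℂ) * Complex.exp (-(s + a) * t)) +
      conj c / 2 * ((t : ℂ) * Complex.exp (-(s + conj a) * t)) := fun t => by
    rw [rampExp, Complex.re_eq_add_conj]
    simp only [map_mul, Complex.conj_ofReal, ← Complex.exp_conj, map_neg, neg_add, add_mul,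
      Complex.exp_add]
    ring
  rw [laplace]
  simp only [key]
  rw [integral_add ((integrable_mul_exp_neg h1).const_mul _)
    ((integrable_mul_exp_neg h2).const_mul _), integral_const_mul, integral_const_mul,
    integral_mul_exp_neg h1, integral_mul_exp_neg h2]
  ring

/-- Since `Re a ≥ 1`, `s + a` has modulus at least `1`, so it dominates both `1` and, up to the
factor `1 + ‖a‖`, `s` itself. -/
theorem norm_div_add_sq_le (c a : ℂ) {s : ℂ} (ha : 1 ≤ a.re) (hs : 0 < s.re) :
    ‖c / (s + a) ^ 2‖ ≤ ‖c‖ * (1 + (1 + ‖a‖) ^ 2) / (1 + ‖s‖ ^ 2) := by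
  have h1 : 1 ≤ ‖s + a‖ := (by simp; linarith : (1 : ℝ) ≤ (s + a).re).trans (Complex.re_le_norm _)
  have h2 : ‖s‖ ≤ (1 + ‖a‖) * ‖s + a‖ := by
    have : ‖s‖ ≤ ‖s + a‖ + ‖a‖ := by simpa using norm_sub_le (s + a) a
    nlinarith [norm_nonneg a]
  have h3 : 1 + ‖s‖ ^ 2 ≤ (1 + (1 + ‖a‖) ^ 2) * ‖s + a‖ ^ 2 := by
    have := pow_le_pow_left₀ (norm_nonneg s) h2 2
    nlinarith
  rw [norm_div, norm_pow, div_le_div_iff₀ (by positivity) (by positivity), mul_assoc]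
  gcongr

theorem rampExp_mem_decaySpace (c : ℂ) {a : ℂ} (ha : 1 ≤ a.re) :
    (memLp_rampExp c (one_pos.trans_le ha)).toLp _ ∈ decaySpace := by
  refine ⟨‖c‖ * (1 + (1 + ‖a‖) ^ 2), fun s hs => ?_⟩
  rw [laplace_congr (MemLp.coeFn_toLp _), laplace_rampExp c (one_pos.trans_le ha) hs, norm_div,
    Complex.norm_two, div_le_iff₀ two_pos]
  have h1 := norm_div_add_sq_le c a ha hs
  have h2 := norm_div_add_sq_le (conj c) (conj a) (by simpa using ha) hs
  rw [RCLike.norm_conj, RCLike.norm_conj] at h2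
  linarith [norm_add_le (c / (s + a) ^ 2) (conj c / (s + conj a) ^ 2)]

/-- A signal `f` orthogonal to every `Re (c t e^{-at})` with `Re a = 1` has `t f(t)` with vanishing
Laplace transform on that line, so `t f(t) = 0` almost everywhere. -/
theorem dense_decaySpace : decaySpace.topologicalClosure = ⊤ := by
  rw [Submodule.topologicalClosure_eq_top_iff, Submodule.eq_bot_iff]
  intro f hf
  have hint : ∀ ξ : ℝ, Integrable (fun t : ℝ => (f t : ℂ) *
      ((t : ℂ) * Complex.exp (-(1 + 2 * π * ξ * Complex.I) * t))) timeMeasure := fun ξ => by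
    have hre : (1 + 2 * π * ξ * Complex.I).re = 1 := by simp
    refine ((memLp_exp_neg (by norm_num : (0 : ℝ) < 1 / 2)).const_mul 2).integrable_mul
      (Lp.memLp f) |>.norm.mono' ?_ ?_
    · exact (Complex.continuous_ofReal.comp_aestronglyMeasurable
        (Lp.aestronglyMeasurable f)).mul (by fun_prop)
    · filter_upwards [ae_restrict_mem measurableSet_Ici] with t ht
      have := norm_mul_exp_neg_le (hre ▸ one_pos) ht
      rw [hre, div_one] at this
      rw [norm_mul, mul_comm, Complex.norm_real]
      refine (mul_le_mul_of_nonneg_right this (norm_nonneg _)).trans_eq ?_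
      simp only [Pi.mul_apply, norm_mul, Real.norm_eq_abs, Real.abs_exp, Nat.abs_ofNat]
  have hzero : ∀ ξ : ℝ, laplace (fun t => f t * t) ((1 : ℝ) + 2 * π * ξ * Complex.I) = 0 :=
    fun ξ => by
      set a : ℂ := 1 + 2 * π * ξ * Complex.I with ha
      have hre : a.re = 1 := by simp [ha]
      set A := ∫ t : ℝ, (f t : ℂ) * ((t : ℂ) * Complex.exp (-a * t)) ∂timeMeasure with hA
      have h1 : laplace (fun t => f t * t) ((1 : ℝ) + 2 * π * ξ * Complex.I) = A := by
        rw [laplace, hA]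
        congr 1 with t
        rw [Complex.ofReal_one, ← ha]
        push_cast
        ring
      -- With `c = conj A`, orthogonality reads `|A|² = 0`; one real equation thus kills a complex
      -- number.
      have h2 := (Submodule.mem_orthogonal _ _).1 hf _ (rampExp_mem_decaySpace (conj A) hre.ge)
      have h3 : (conj A * A).re = 0 := by
        have h4 : (conj A * A).re = ∫ t : ℝ, (conj A *
            ((f t : ℂ) * ((t : ℂ) * Complex.exp (-a * t)))).re ∂timeMeasure := by
          refine Eq.trans ?_ (integral_re ((hint ξ).const_mul (conj A))).symm
          rw [integral_const_mul]
          rfl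
        rw [h4, ← h2, L2.inner_def]
        refine integral_congr_ae ?_
        filter_upwards [(memLp_rampExp (conj A) (one_pos.trans_le hre.ge)).coeFn_toLp] with t ht
        rw [ht, rampExp]
        simp only [RCLike.inner_apply]
        rw [show conj A * ((f t : ℂ) * ((t : ℂ) * Complex.exp (-a * t))) =
          (f t : ℂ) * (conj A * ((t : ℂ) * Complex.exp (-a * t))) by ring, Complex.re_ofReal_mul]
        simp
      rw [h1]
      rw [mul_comm, Complex.mul_conj, Complex.ofReal_re] at h3
      exact Complex.normSq_eq_zero.1 h3
  have hI : Integrable (damped (fun t => f t * t) 1) := by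
    rw [integrable_damped_iff]
    refine (hint 0).congr (ae_of_all _ fun t => ?_)
    simp only [Complex.ofReal_zero, mul_zero, zero_mul, add_zero, Complex.ofReal_one,
      Complex.ofReal_mul]
    ring
  have hae : (fun t => f t * t) =ᵐ[timeMeasure] fun _ => 0 :=
    ae_eq_of_laplace_eq hI (by simp [damped]) fun ξ => by
      rw [hzero ξ]
      simp [laplace]
  refine Lp.ext ?_
  filter_upwards [hae, Lp.coeFn_zero ℝ 2 timeMeasure,
    ae_restrict_of_ae (Measure.ae_ne volume (0 : ℝ))] with t h1 h2 h3
  rw [h2]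
  simpa [h3] using h1

end DecaySpace

/-! ### Shifting vertical contours -/

section Contour

open Filter Topology FourierTransform
open scoped Real

theorem integrable_vertical {H : ℂ → ℂ} {C x : ℝ}
    (hc : Continuous fun y : ℝ => H (x + y * Complex.I))
    (hb : ∀ y : ℝ, ‖H (x + y * Complex.I)‖ ≤ C / (1 + ‖(x + y * Complex.I : ℂ)‖ ^ 2)) :
    Integrable fun y : ℝ => H (x + y * Complex.I) := by
  refine (integrable_inv_one_add_sq.const_mul C).mono' hc.aestronglyMeasurable
    (ae_of_all _ fun y => (hb y).trans ?_)
  have hC : 0 ≤ C := by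
    have := (norm_nonneg _).trans (hb y)
    by_contra h
    exact absurd this (not_le.2 (div_neg_of_neg_of_pos (not_le.1 h) (by positivity)))
  rw [div_eq_mul_inv]
  have : y ^ 2 ≤ ‖(x + y * Complex.I : ℂ)‖ ^ 2 := by
    rw [← Complex.normSq_eq_norm_sq, Complex.normSq_add_mul_I]
    nlinarith [sq_nonneg x]
  gcongr

/-- Cauchy's theorem on the rectangles `[a, b] × [-N, N]`; the horizontal sides vanish in the limit.
-/
theorem integral_vertical_eq {H : ℂ → ℂ} {C a b : ℝ} (hab : a ≤ b)
    (hd : ∀ s : ℂ, s.re ∈ Icc a b → DifferentiableAt ℂ H s)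
    (hb : ∀ s : ℂ, s.re ∈ Icc a b → ‖H s‖ ≤ C / (1 + ‖s‖ ^ 2)) :
    ∫ y : ℝ, H (a + y * Complex.I) = ∫ y : ℝ, H (b + y * Complex.I) := by
  have hre : ∀ x y : ℝ, (x + y * Complex.I : ℂ).re = x := fun x y => by simp
  have hint : ∀ x ∈ Icc a b, Integrable fun y : ℝ => H (x + y * Complex.I) := fun x hx =>
    integrable_vertical (continuous_iff_continuousAt.2 fun y =>
      ((hd _ (by rwa [hre])).continuousAt.comp
        (by fun_prop : Continuous fun y : ℝ => (x + y * Complex.I : ℂ)).continuousAt))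
      fun y => hb _ (by rwa [hre])
  have hC : 0 ≤ C := by
    have := (norm_nonneg _).trans (hb a (by simpa using hab))
    by_contra h
    exact absurd this (not_le.2 (div_neg_of_neg_of_pos (not_le.1 h) (by positivity)))
  -- The sign `e = ±1` treats the top and bottom sides together. The crude bound `N ≤ |s|²`
  -- suffices.
  have hhor : ∀ e : ℝ, e ^ 2 = 1 → Tendsto (fun N : ℕ =>
      ∫ x : ℝ in a..b, H (x + ((e * N : ℝ) : ℂ) * Complex.I)) atTop (𝓝 0) := fun e he => by
    refine squeeze_zero_norm (a := fun N : ℕ => C * |b - a| * (1 / ((N : ℝ) + 1))) (fun N => ?_) ?_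
    · have hN : ∀ x ∈ uIoc a b, ‖H (x + ((e * N : ℝ) : ℂ) * Complex.I)‖ ≤ C / ((N : ℝ) + 1) := by
        intro x hx
        rw [uIoc_of_le hab] at hx
        refine (hb _ (by rw [hre]; exact ⟨hx.1.le, hx.2⟩)).trans ?_
        have h1 : (N : ℝ) ≤ ‖(x + ((e * N : ℝ) : ℂ) * Complex.I : ℂ)‖ ^ 2 := by
          rw [← Complex.normSq_eq_norm_sq, Complex.normSq_add_mul_I, mul_pow, he, one_mul]
          have : (N : ℝ) ≤ (N : ℝ) ^ 2 := by exact_mod_cast Nat.le_self_pow two_ne_zero N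
          nlinarith [sq_nonneg x]
        exact div_le_div_of_nonneg_left hC (by positivity) (by linarith)
      calc _ ≤ C / ((N : ℝ) + 1) * |b - a| := intervalIntegral.norm_integral_le_of_norm_le_const hN
        _ = _ := by ring
    · simpa using tendsto_one_div_add_atTop_nhds_zero_nat.const_mul (C * |b - a|)
  have hver : ∀ x ∈ Icc a b, Tendsto (fun N : ℕ =>
      ∫ y : ℝ in (-1 * N : ℝ)..(1 * N : ℝ), H (x + y * Complex.I)) atTop
      (𝓝 (∫ y : ℝ, H (x + y * Complex.I))) := fun x hx =>
    intervalIntegral_tendsto_integral (hint x hx)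
      (by simpa using tendsto_natCast_atTop_atTop)
      (by simpa using tendsto_natCast_atTop_atTop)
  have hrect : ∀ N : ℕ, (∫ x : ℝ in a..b, H (x + ((-1 * N : ℝ) : ℂ) * Complex.I)) -
      (∫ x : ℝ in a..b, H (x + ((1 * N : ℝ) : ℂ) * Complex.I)) +
      Complex.I * (∫ y : ℝ in (-1 * N : ℝ)..(1 * N : ℝ), H (b + y * Complex.I)) -
      Complex.I * (∫ y : ℝ in (-1 * N : ℝ)..(1 * N : ℝ), H (a + y * Complex.I)) = 0 := fun N => by
    have := Complex.integral_boundary_rect_eq_zero_of_differentiableOn H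
      (⟨a, -1 * N⟩ : ℂ) (⟨b, 1 * N⟩ : ℂ) fun s hs => (hd s (by
        have h := hs.1
        rwa [mem_preimage, uIcc_of_le hab] at h)).differentiableWithinAt
    simpa only [smul_eq_mul] using this
  have hlim := (((hhor (-1) (by norm_num)).sub (hhor 1 (by norm_num))).add
    ((hver b (right_mem_Icc.2 hab)).const_mul Complex.I)).sub
    ((hver a (left_mem_Icc.2 hab)).const_mul Complex.I)
  simp only [hrect] at hlim
  have h0 := tendsto_nhds_unique hlim tendsto_const_nhds
  have h1 : Complex.I * ((∫ y : ℝ, H (b + y * Complex.I)) - ∫ y : ℝ, H (a + y * Complex.I)) = 0 := by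
    linear_combination h0
  exact (sub_eq_zero.1 ((mul_eq_zero.1 h1).resolve_left Complex.I_ne_zero)).symm

/-- The signal `e^{xt} 𝓕⁻¹(F(x + 2πi·))(t)` does not depend on the abscissa `x`. -/
theorem exp_mul_fourierInv_vertical_eq {F : ℂ → ℂ} {C : ℝ}
    (hd : DifferentiableOn ℂ F {s | 0 < s.re})
    (hb : ∀ s : ℂ, 0 < s.re → ‖F s‖ ≤ C / (1 + ‖s‖ ^ 2)) {a b : ℝ} (ha : 0 < a) (hb' : 0 < b)
    (t : ℝ) :
    Complex.exp (a * t) * 𝓕⁻ (fun ξ : ℝ => F (a + 2 * π * ξ * Complex.I)) t =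
      Complex.exp (b * t) * 𝓕⁻ (fun ξ : ℝ => F (b + 2 * π * ξ * Complex.I)) t := by
  wlog hab : a ≤ b generalizing a b
  · exact (this hb' ha (le_of_not_ge hab)).symm
  -- The substitution `y = 2πξ` gives the Bromwich integral of `F(s) e^{st}`, whose integrand is
  -- holomorphic in `s`.
  have key : ∀ x : ℝ,
      Complex.exp (x * t) * 𝓕⁻ (fun ξ : ℝ => F (x + 2 * π * ξ * Complex.I)) t =
      |(2 * π)⁻¹| • ∫ y : ℝ, F (x + y * Complex.I) * Complex.exp ((x + y * Complex.I) * t) :=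
    fun x => by
      rw [← Measure.integral_comp_mul_left, Real.fourierInv_eq', ← integral_const_mul]
      congr 1 with ξ
      rw [add_mul, Complex.exp_add]
      simp only [RCLike.inner_apply, conj_trivial, smul_eq_mul]
      push_cast
      rw [show 2 * (π : ℂ) * (t * ξ) * Complex.I = 2 * π * ξ * Complex.I * t by ring]
      ring
  rw [key, key]
  congr 1
  -- On the strip `|e^{st}| ≤ e^{b|t|}`, which fixes the constant.
  refine integral_vertical_eq (H := fun s => F s * Complex.exp (s * t))
    (C := C * Real.exp (b * |t|)) hab (fun s hs => ?_) fun s hs => ?_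
  · have : DifferentiableAt ℂ F s := (hd s (ha.trans_le hs.1)).differentiableAt
      ((isOpen_lt continuous_const Complex.continuous_re).mem_nhds (ha.trans_le hs.1))
    fun_prop
  · have hs0 : 0 < s.re := ha.trans_le hs.1
    rw [norm_mul, Complex.norm_exp, mul_div_right_comm]
    have h2 : (s * t).re ≤ b * |t| := by
      rw [Complex.re_mul_ofReal]
      exact (mul_le_mul_of_nonneg_left (le_abs_self t) hs0.le).trans
        (mul_le_mul_of_nonneg_right hs.2 (abs_nonneg t))
    exact mul_le_mul (hb s hs0) (Real.exp_le_exp.2 h2) (Real.exp_pos _).le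
      ((norm_nonneg _).trans (hb s hs0))

end Contour

/-! ### Bounded multipliers on the right half-plane act boundedly on `L₂` -/

section Multiplier

open Filter Topology FourierTransform
open scoped Real

theorem isOpen_re_pos : IsOpen {s : ℂ | 0 < s.re} :=
  isOpen_lt continuous_const Complex.continuous_re

theorem exp_mul_damped (y : ℝ → ℝ) (x t : ℝ) :
    Complex.exp (x * t) * damped y x t = (Ici (0 : ℝ)).indicator (fun t => (y t : ℂ)) t := by
  by_cases ht : t ∈ Ici (0 : ℝ)
  · simp only [damped, indicator_of_mem ht]
    rw [← mul_assoc, ← Complex.exp_add]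
    simp
  · simp [damped, indicator_of_notMem ht]

/-- If `Y = G U` far to the right, `|G| ≤ M` on the right half-plane and `U` decays, then
`‖y‖ ≤ M ‖u‖`. -/
theorem eLpNorm_le_of_laplace_eq_mul {G : ℂ → ℂ} (hG : DifferentiableOn ℂ G {s | 0 < s.re}) {M : ℝ}
    (hM : ∀ s : ℂ, 0 < s.re → ‖G s‖ ≤ M) {u y : ℝ → ℝ} (hu : MemLp u 2 timeMeasure) {C : ℝ}
    (hC : ∀ s : ℂ, 0 < s.re → ‖laplace u s‖ ≤ C / (1 + ‖s‖ ^ 2))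
    (hy : AEStronglyMeasurable y timeMeasure) {x₁ : ℝ} (hx₁ : 0 < x₁)
    (hyi : Integrable (damped y x₁))
    (hyG : ∀ s : ℂ, s.re = x₁ → laplace y s = G s * laplace u s) :
    eLpNorm y 2 timeMeasure ≤ ENNReal.ofReal M * eLpNorm u 2 timeMeasure := by
  set F : ℂ → ℂ := fun s => G s * laplace u s with hF
  have hre : ∀ x ξ : ℝ, (x + 2 * π * ξ * Complex.I : ℂ).re = x := fun x ξ => by simp
  have hM0 : 0 ≤ M := (norm_nonneg _).trans (hM 1 (by simp))
  have hFd : DifferentiableOn ℂ F {s | 0 < s.re} := hG.mul (differentiableOn_laplace hu)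
  have hFb : ∀ s : ℂ, 0 < s.re → ‖F s‖ ≤ M * C / (1 + ‖s‖ ^ 2) := fun s hs => by
    rw [norm_mul, mul_div_assoc]
    exact mul_le_mul (hM s hs) (hC s hs) (norm_nonneg _) hM0
  have hcont : ∀ {x : ℝ}, 0 < x → Continuous fun y : ℝ => F (x + y * Complex.I) := fun {x} hx =>
    hFd.continuousOn.comp_continuous (by fun_prop) fun y => by simpa using hx
  have hint : ∀ {x : ℝ}, 0 < x → Integrable fun ξ : ℝ => F (x + 2 * π * ξ * Complex.I) :=
    fun {x} hx => by
      have := (integrable_vertical (hcont hx) fun y => hFb _ (by simpa using hx)).comp_mul_left'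
        (by positivity : (2 * π : ℝ) ≠ 0)
      simpa using this
  -- The pointwise bound `|G| ≤ M`, followed by Plancherel for the damped input.
  have hnorm : ∀ {x : ℝ}, 0 < x → eLpNorm (fun ξ : ℝ => F (x + 2 * π * ξ * Complex.I)) 2 volume ≤
      ENNReal.ofReal M * eLpNorm u 2 timeMeasure := fun {x} hx => by
    refine (eLpNorm_le_mul_eLpNorm_of_ae_le_mul (g := 𝓕 (damped u x)) (c := M)
      (ae_of_all _ fun ξ => ?_) 2).trans ?_
    · rw [← laplace_eq_fourier, hF, norm_mul]
      exact mul_le_mul_of_nonneg_right (hM _ (by rwa [hre])) (norm_nonneg _)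
    · rw [eLpNorm_fourier (integrable_damped hu hx) (memLp_damped hu hx.le)]
      gcongr
      exact eLpNorm_damped_le hx.le
  have hinv : damped y x₁ =ᵐ[volume] 𝓕⁻ (fun ξ : ℝ => F (x₁ + 2 * π * ξ * Complex.I)) := by
    have h : 𝓕 (damped y x₁) = fun ξ : ℝ => F (x₁ + 2 * π * ξ * Complex.I) := funext fun ξ => by
      rw [← laplace_eq_fourier, hyG _ (hre _ _)]
    rw [← h]
    exact ae_eq_fourierInv_fourier hyi (h ▸ hint hx₁)
  refine eLpNorm_le_of_damped hy fun x hx => ?_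
  -- Undoing the damping makes both sides independent of the abscissa, so inversion on the line `x₁`
  -- transfers to every `x > 0`.
  have hae : damped y x =ᵐ[volume] 𝓕⁻ (fun ξ : ℝ => F (x + 2 * π * ξ * Complex.I)) := by
    filter_upwards [hinv] with t ht
    refine mul_left_cancel₀ (Complex.exp_ne_zero (x * t)) ?_
    rw [exp_mul_damped, exp_mul_fourierInv_vertical_eq hFd hFb hx hx₁, ← ht, exp_mul_damped]
  rw [eLpNorm_congr_ae hae, eLpNorm_fourierInv (hint hx)
    ⟨(hint hx).aestronglyMeasurable, (hnorm hx).trans_lt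
      (ENNReal.mul_lt_top ENNReal.ofReal_lt_top hu.eLpNorm_lt_top)⟩]
  exact hnorm hx

/-- Evaluation of the Laplace transform as a continuous linear functional. -/
noncomputable def laplaceCLM (s : ℂ) (hs : 0 < s.re) : L2 →L[ℝ] ℂ :=
  LinearMap.mkContinuousOfExistsBound
    { toFun := fun u => laplace u s
      map_add' := fun u v => by
        rw [laplace_congr (Lp.coeFn_add u v), laplace_add (Lp.memLp u) (Lp.memLp v) hs]
      map_smul' := fun c u => by
        rw [laplace_congr (Lp.coeFn_smul c u), laplace_smul]
        simp }
    (exists_norm_laplace_le hs)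

theorem laplaceCLM_apply (s : ℂ) (hs : 0 < s.re) (u : L2) : laplaceCLM s hs u = laplace u s := rfl

/-- A linear system with a transfer function bounded by `M` on the right half-plane maps `L₂` to
`L₂`, with gain at most `M`. -/
theorem exists_clm_of_represents {R : L2e → L2e} (hR : IsLinearMap ℝ R) {G : ℂ → ℂ}
    (hrep : Represents G R) (hG : DifferentiableOn ℂ G {s | 0 < s.re}) {M : ℝ}
    (hM : ∀ s : ℂ, 0 < s.re → ‖G s‖ ≤ M) :
    ∃ T : L2 →L[ℝ] L2, (∀ u : L2, (R u.toL2e).1 = (T u).1) ∧ ∀ u : L2, ‖T u‖ ≤ M * ‖u‖ := by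
  obtain ⟨σ, hσ, hrep⟩ := hrep
  have hM0 : 0 ≤ M := (norm_nonneg _).trans (hM 1 (by simp))
  have hx₁ : 0 < σ + 1 := by linarith
  have hdamped : ∀ u : L2, Integrable (damped (R u.toL2e).1 (σ + 1)) := fun u =>
    integrable_damped_iff.2 (hrep u _ (by simp)).1
  have hbound : ∀ u ∈ decaySpace, eLpNorm (R (L2.toL2e u)).1 2 timeMeasure ≤
      ENNReal.ofReal M * eLpNorm u 2 timeMeasure := by
    rintro u ⟨C, hC⟩
    exact eLpNorm_le_of_laplace_eq_mul hG hM (Lp.memLp u) hC (AEEqFun.aestronglyMeasurable _) hx₁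
      (hdamped u) fun s hs => (hrep u s (by linarith)).2
  have hmem : ∀ u ∈ decaySpace, (R (L2.toL2e u)).1 ∈ Lp ℝ 2 timeMeasure := fun u hu =>
    Lp.mem_Lp_iff_eLpNorm_lt_top.2 ((hbound u hu).trans_lt
      (ENNReal.mul_lt_top ENNReal.ofReal_lt_top (Lp.eLpNorm_lt_top u)))
  let T₀ : decaySpace →ₗ[ℝ] L2 :=
    { toFun := fun u => ⟨(R (L2.toL2e u.1)).1, hmem u.1 u.2⟩
      map_add' := fun u v => Subtype.ext
        (congrArg (fun w : L2e => w.1) (hR.map_add u.1.toL2e v.1.toL2e))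
      map_smul' := fun c u => Subtype.ext
        (congrArg (fun w : L2e => w.1) (hR.map_smul c u.1.toL2e)) }
  have hT₀ : ∀ u, ‖T₀ u‖ ≤ M * ‖u‖ := fun u => by
    have h := ENNReal.toReal_mono (ENNReal.mul_lt_top ENNReal.ofReal_lt_top
      (Lp.eLpNorm_lt_top u.1)).ne (hbound u.1 u.2)
    rwa [ENNReal.toReal_mul, ENNReal.toReal_ofReal hM0] at h
  have hdense : DenseRange decaySpace.subtypeL := by
    have := Submodule.dense_iff_topologicalClosure_eq_top.2 dense_decaySpace
    simpa [DenseRange] using this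
  let T₁ : decaySpace →L[ℝ] L2 := T₀.mkContinuous M hT₀
  let T : L2 →L[ℝ] L2 := T₁.extend decaySpace.subtypeL
  have hT : ∀ u : decaySpace, T u = T₀ u := fun u =>
    ContinuousLinearMap.extend_eq T₁ hdense isUniformEmbedding_subtype_val.isUniformInducing u
  -- Both sides are continuous in `u`, so the identity passes from the dense subspace to `L₂`.
  have hlap : ∀ (u : L2) (s : ℂ), σ < s.re → laplace (T u) s = G s * laplace u s :=
    fun u s hs => by
      have hs0 : 0 < s.re := hσ.trans_lt hs
      simp only [← laplaceCLM_apply s hs0]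
      refine hdense.induction_on (p := fun u => laplaceCLM s hs0 (T u) = G s * laplaceCLM s hs0 u) u
        (isClosed_eq (by fun_prop) (by fun_prop)) fun v => ?_
      rw [Submodule.subtypeL_apply, hT]
      exact (hrep v.1 s hs).2
  refine ⟨T, fun u => AEEqFun.ext ?_, fun u => ?_⟩
  -- No continuity of `R` is available; `R u` and `T u` coincide because their transforms agree on
  -- the line `Re s = σ + 1`.
  · refine ae_eq_of_laplace_eq (hdamped u) (integrable_damped (Lp.memLp (T u)) hx₁) fun ξ => ?_
    rw [(hrep u _ (by simp)).2, hlap u _ (by simp)]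
  · refine hdense.induction_on (p := fun u => ‖T u‖ ≤ M * ‖u‖) u
      (isClosed_le (by fun_prop) (by fun_prop)) fun v => ?_
    rw [Submodule.subtypeL_apply, hT]
    exact hT₀ v

/-- The Laplace transform at `x + jb` through two real inner products. -/
theorem laplace_eq_inner {u₁ u₂ : L2} {s : ℂ}
    (h₁ : u₁ =ᵐ[timeMeasure] fun t => (Complex.exp (-s * t)).re)
    (h₂ : u₂ =ᵐ[timeMeasure] fun t => -(Complex.exp (-s * t)).im) (v : L2) :
    laplace v s = inner ℝ u₁ v - Complex.I * inner ℝ u₂ v := by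
  have hi : ∀ u : L2, Integrable (fun t => ((inner ℝ (u t) (v t) : ℝ) : ℂ)) timeMeasure :=
    fun u => (L2.integrable_inner (𝕜 := ℝ) u v).ofReal
  rw [L2.inner_def, L2.inner_def, ← integral_complex_ofReal, ← integral_complex_ofReal,
    ← integral_const_mul, ← integral_sub (hi u₁) ((hi u₂).const_mul _), laplace]
  refine integral_congr_ae ?_
  filter_upwards [h₁, h₂] with t h1 h2
  rw [h1, h2]
  conv_lhs => rw [← Complex.re_add_im (Complex.exp (-s * t))]
  simp only [RCLike.inner_apply, conj_trivial]
  push_cast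
  ring

/-- A transfer function is bounded, on the right half-plane, by the gain of the system. -/
theorem norm_le_of_laplace_eq_mul {G : ℂ → ℂ} {T : L2 →L[ℝ] L2} {s : ℂ} (hs : 0 < s.re)
    (hT : ∀ u : L2, laplace (T u) s = G s * laplace u s) {γ : ℝ}
    (hγ : ∀ u : L2, ‖T u‖ ≤ γ * ‖u‖) : ‖G s‖ ≤ γ := by
  have hm : ∀ f : ℂ → ℝ, Continuous f → (∀ z, ‖f z‖ ≤ ‖z‖) →
      MemLp (fun t : ℝ => f (Complex.exp (-s * t))) 2 timeMeasure := fun f hf hfn =>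
    (memLp_exp_neg hs).of_le (by fun_prop) (ae_of_all _ fun t => by
      rw [Real.norm_eq_abs (Real.exp _), Real.abs_exp, ← norm_exp_neg_mul]
      exact hfn _)
  have hm₁ := hm Complex.re Complex.continuous_re Complex.abs_re_le_norm
  have hm₂ := hm (fun z => -z.im) Complex.continuous_im.neg
    fun z => by simpa using Complex.abs_im_le_norm z
  -- `u₁ + i u₂` is the kernel `e^{-s̄t}` and `N` below is its squared norm, positive because the
  -- exponential never vanishes.
  set u₁ : L2 := hm₁.toLp _
  set u₂ : L2 := hm₂.toLp _
  have hin : ∀ v : L2, laplace v s = inner ℝ u₁ v - Complex.I * inner ℝ u₂ v :=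
    laplace_eq_inner hm₁.coeFn_toLp hm₂.coeFn_toLp
  set N : ℝ := ‖u₁‖ ^ 2 + ‖u₂‖ ^ 2 with hN
  have hNpos : 0 < N := by
    rcases eq_or_ne u₁ 0 with h1 | h1
    · rcases eq_or_ne u₂ 0 with h2 | h2
      · exfalso
        have hne : timeMeasure ≠ 0 := by
          rw [Ne, Measure.restrict_eq_zero]
          simp
        have : ∀ᵐ t ∂timeMeasure, False := by
          filter_upwards [hm₁.coeFn_toLp, hm₂.coeFn_toLp, Lp.coeFn_zero ℝ 2 timeMeasure]
            with t a b c
          have a' : u₁ t = 0 := by rw [h1, c]; rfl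
          have b' : u₂ t = 0 := by rw [h2, c]; rfl
          exact Complex.exp_ne_zero (-s * t)
            (Complex.ext (a.symm.trans a') (neg_eq_zero.1 (b.symm.trans b')))
        exact hne (ae_eq_bot.1 (Filter.empty_mem_iff_bot.1 this))
      · positivity
    · positivity
  set A : ℝ := inner ℝ u₁ (T u₁) + inner ℝ u₂ (T u₂) with hA
  set B : ℝ := inner ℝ u₁ (T u₂) - inner ℝ u₂ (T u₁) with hB
  -- The Laplace transform at `s` of the image of the kernel `u₁ + i u₂` under complexified `T`,
  -- computed in two ways.
  have hAB : G s * N = A + B * Complex.I := by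
    have e1 := hT u₁
    have e2 := hT u₂
    rw [hin, hin] at e1 e2
    rw [hN, ← real_inner_self_eq_norm_sq, ← real_inner_self_eq_norm_sq, hA, hB]
    rw [real_inner_comm u₁ u₂] at e1
    push_cast
    linear_combination -e1 - Complex.I * e2 + (G s * (inner ℝ u₂ u₂ : ℝ) -
      (inner ℝ u₂ (T u₂) : ℝ)) * Complex.I_mul_I
  -- Multiplying the kernel by the unit number `c + id` preserves its norm; pairing it with the
  -- image of the unrotated kernel has real part `cA + dB`. The choice `(c, d) = (A, B) / r` then
  -- recovers the full modulus.
  have hrot : ∀ c d : ℝ, c ^ 2 + d ^ 2 = 1 → c * A + d * B ≤ γ * N := fun c d hcd => by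
    have e : c * A + d * B =
        inner ℝ (c • u₁ - d • u₂) (T u₁) + inner ℝ (c • u₂ + d • u₁) (T u₂) := by
      simp only [hA, hB, inner_sub_left, inner_add_left, real_inner_smul_left]
      ring
    have hsum : ‖c • u₁ - d • u₂‖ ^ 2 + ‖c • u₂ + d • u₁‖ ^ 2 = N := by
      rw [norm_sub_sq_real, norm_add_sq_real]
      simp only [norm_smul, real_inner_smul_left, real_inner_smul_right, mul_pow,
        Real.norm_eq_abs, sq_abs, real_inner_comm u₁ u₂]
      linear_combination (‖u₁‖ ^ 2 + ‖u₂‖ ^ 2) * hcd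
    have hγ0 : 0 ≤ γ := by
      by_contra h
      rcases eq_or_ne u₁ 0 with h1 | h1
      · rcases eq_or_ne u₂ 0 with h2 | h2
        · simp [hN, h1, h2] at hNpos
        · exact absurd (norm_nonneg (T u₂)) (not_le.2 ((hγ u₂).trans_lt
            (mul_neg_of_neg_of_pos (not_le.1 h) (norm_pos_iff.2 h2))))
      · exact absurd (norm_nonneg (T u₁)) (not_le.2 ((hγ u₁).trans_lt
            (mul_neg_of_neg_of_pos (not_le.1 h) (norm_pos_iff.2 h1))))
    have hpair : ∀ v w : L2, inner ℝ v (T w) ≤ γ * ((‖v‖ ^ 2 + ‖w‖ ^ 2) / 2) := fun v w => by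
      calc inner ℝ v (T w) ≤ ‖v‖ * ‖T w‖ := real_inner_le_norm _ _
        _ ≤ ‖v‖ * (γ * ‖w‖) := by gcongr; exact hγ w
        _ = γ * (‖v‖ * ‖w‖) := by ring
        _ ≤ _ := by
          gcongr
          nlinarith [sq_nonneg (‖v‖ - ‖w‖)]
    rw [e]
    calc _ ≤ _ := add_le_add (hpair _ _) (hpair _ _)
      _ = γ * N := by linear_combination (γ / 2) * hsum
  have hnorm : ‖G s‖ * N = ‖(A + B * Complex.I : ℂ)‖ := by
    rw [← hAB, norm_mul, Complex.norm_real, Real.norm_of_nonneg hNpos.le]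
  have hsq : ‖(A + B * Complex.I : ℂ)‖ ^ 2 = A ^ 2 + B ^ 2 := by
    rw [← Complex.normSq_eq_norm_sq, Complex.normSq_add_mul_I]
  set r := ‖(A + B * Complex.I : ℂ)‖ with hr
  have hfin : r ≤ γ * N := by
    rcases (norm_nonneg (A + B * Complex.I : ℂ)).eq_or_lt with h0 | h0
    · have h1 := hrot 1 0 (by norm_num)
      have h2 := hrot (-1) 0 (by norm_num)
      rw [← hr] at h0
      linarith
    · rw [← hr] at h0
      have h1 := hrot (A / r) (B / r) (by field_simp; exact hsq.symm)
      have h2 : A / r * A + B / r * B = r := by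
        field_simp
        linarith
      linarith
  exact le_of_mul_le_mul_right (hnorm ▸ hfin) hNpos

end Multiplier

/-! ### Stable proper transfer functions -/

section TransferFunction

open Filter Topology Bornology

/-- The quotient is the reversed polynomial at `1/s`, whose constant coefficient is the leading
coefficient of `p`. -/
theorem tendsto_eval_div_pow (p : ℂ[X]) :
    Tendsto (fun s : ℂ => p.eval s / s ^ p.natDegree) (cobounded ℂ) (𝓝 p.leadingCoeff) := by
  have h : Tendsto (fun s : ℂ => p.reverse.eval s⁻¹) (cobounded ℂ) (𝓝 (p.reverse.eval 0)) :=
    (p.reverse.continuous.tendsto 0).comp tendsto_inv₀_cobounded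
  rw [← coeff_zero_eq_eval_zero, coeff_zero_reverse] at h
  refine h.congr' ?_
  filter_upwards [eventually_ne_cobounded (0 : ℂ)] with s hs
  have : Invertible s := invertibleOfNonzero hs
  have := eval₂_reverse_mul_pow (RingHom.id ℂ) s p
  rw [invOf_eq_inv] at this
  rw [eq_div_iff (pow_ne_zero _ hs)]
  exact this

theorem tendsto_rational {G : ℂ → ℂ} {a b : ℂ[X]} (ha : a ≠ 0)
    (hG : ∀ s : ℂ, a.eval s ≠ 0 → G s = b.eval s / a.eval s) :
    Tendsto (fun s : ℂ => G s * (s ^ a.natDegree / s ^ b.natDegree)) (cobounded ℂ)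
      (𝓝 (b.leadingCoeff / a.leadingCoeff)) := by
  have hlc : a.leadingCoeff ≠ 0 := leadingCoeff_ne_zero.2 ha
  refine ((tendsto_eval_div_pow b).div (tendsto_eval_div_pow a) hlc).congr' ?_
  filter_upwards [(tendsto_eval_div_pow a).eventually_ne hlc, eventually_ne_cobounded (0 : ℂ)]
    with s hs hs0
  have has : a.eval s ≠ 0 := fun h => hs (by rw [h, zero_div])
  rw [hG s has, Pi.div_apply]
  field_simp

theorem laplace_exp_neg {s : ℂ} (hs : 0 < s.re) :
    laplace (fun t => Real.exp (-1 * t)) s = 1 / (s + 1) := by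
  have h := integral_exp_mul_complex_Ioi (a := -(s + 1)) (by simp; linarith) 0
  rw [laplace, integral_Ici_eq_integral_Ioi]
  calc _ = ∫ t : ℝ in Ioi 0, Complex.exp (-(s + 1) * t) := by
        congr 1 with t
        rw [Complex.ofReal_exp, ← Complex.exp_add]
        congr 1
        push_cast
        ring
    _ = _ := by
        rw [h, neg_div_neg_eq]
        simp

/-- Dominated convergence with the integrand at `x₁` as majorant; only absolute convergence there is
needed, not `y ∈ L₂`. -/
theorem tendsto_laplace_atTop {y : ℝ → ℝ} (hy : AEStronglyMeasurable y timeMeasure) {x₁ : ℝ}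
    (hi : Integrable (fun t : ℝ => Complex.exp (-(x₁ : ℂ) * t) * (y t : ℂ)) timeMeasure) :
    Tendsto (fun x : ℝ => laplace y x) atTop (𝓝 0) := by
  have hmeas : ∀ x : ℝ, AEStronglyMeasurable
      (fun t : ℝ => Complex.exp (-(x : ℂ) * t) * (y t : ℂ)) timeMeasure := fun x =>
    (by fun_prop : Continuous fun t : ℝ => Complex.exp (-(x : ℂ) * t)).aestronglyMeasurable.mul
      (Complex.continuous_ofReal.comp_aestronglyMeasurable hy)
  have h := tendsto_integral_filter_of_dominated_convergence (μ := timeMeasure) (l := atTop)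
    (F := fun (x : ℝ) (t : ℝ) => Complex.exp (-(x : ℂ) * t) * (y t : ℂ)) (f := fun _ => 0)
    (fun t => ‖Complex.exp (-(x₁ : ℂ) * t) * (y t : ℂ)‖) (Eventually.of_forall hmeas) ?_ hi.norm ?_
  · rwa [integral_zero] at h
  · filter_upwards [eventually_ge_atTop x₁] with x hx
    filter_upwards [ae_restrict_mem measurableSet_Ici] with t (ht : 0 ≤ t)
    rw [norm_mul, norm_mul, norm_exp_neg_mul, norm_exp_neg_mul]
    gcongr
    simpa using hx
  · filter_upwards [ae_restrict_mem measurableSet_Ici,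
      ae_restrict_of_ae (Measure.ae_ne volume (0 : ℝ))] with t (ht : 0 ≤ t) h0
    have htpos : 0 < t := lt_of_le_of_ne ht (Ne.symm h0)
    rw [tendsto_zero_iff_norm_tendsto_zero]
    simp only [norm_mul, norm_exp_neg_mul, Complex.ofReal_re]
    have : Tendsto (fun x : ℝ => Real.exp (-x * t)) atTop (𝓝 0) := by
      refine Real.tendsto_exp_atBot.comp ?_
      simpa only [neg_mul] using! tendsto_neg_atTop_atBot.comp (tendsto_id.atTop_mul_const htpos)
    simpa using this.mul_const ‖(y t : ℂ)‖

/-- A rational transfer function is proper. -/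
theorem IsRational.isProper {G : ℂ → ℂ} {R : L2e → L2e} (hG : IsRational G)
    (hrep : Represents G R) : IsProper G := by
  obtain ⟨a, b, ha, hab⟩ := hG
  have hlim := tendsto_rational ha hab
  rcases le_or_gt b.natDegree a.natDegree with hdeg | hdeg
  · have hev : ∀ᶠ s in cobounded ℂ, ‖G s‖ ≤ ‖b.leadingCoeff / a.leadingCoeff‖ + 1 := by
      filter_upwards [hlim.norm.eventually_le_const (lt_add_one _),
        tendsto_norm_cobounded_atTop.eventually_ge_atTop 1] with s h1 h2
      refine le_trans ?_ h1
      rw [norm_mul, norm_div, norm_pow, norm_pow]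
      refine le_mul_of_one_le_right (norm_nonneg _) ?_
      rw [one_le_div₀ (by positivity)]
      exact pow_le_pow_right₀ h2 hdeg
    obtain ⟨ρ, -, hρ⟩ := (hasBasis_cobounded_norm (E := ℂ)).eventually_iff.1 hev
    exact ⟨ρ, _, fun s _ hs => hρ hs⟩
  -- For the input `e^{-t}` the output transform `Y(x) = G(x) / (x + 1)` tends to `0`. As `deg b ≥
  -- deg a + 1` and `x + 1 ≤ 2x` for `x ≥ 1`, the normalized quotient is at most `2 |Y(x)|`, against
  -- its nonzero limit.
  · exfalso
    have hb : b ≠ 0 := fun h => by simp [h] at hdeg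
    obtain ⟨σ, hσ, hrep⟩ := hrep
    set e : L2 := (memLp_exp_neg one_pos).toLp _ with he
    set y := (R e.toL2e).1
    have hY : Tendsto (fun x : ℝ => laplace y x) atTop (𝓝 0) :=
      tendsto_laplace_atTop y.aestronglyMeasurable (x₁ := σ + 1) (hrep e _ (by simp)).1
    have hreal : Tendsto (fun x : ℝ => (x : ℂ)) atTop (cobounded ℂ) := by
      rw [← tendsto_norm_atTop_iff_cobounded]
      simpa using tendsto_abs_atTop_atTop
    have h0 : Tendsto (fun x : ℝ => G x * ((x : ℂ) ^ a.natDegree / (x : ℂ) ^ b.natDegree)) atTop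
        (𝓝 0) := by
      have hY2 := (hY.norm.mul_const 2)
      rw [norm_zero, zero_mul] at hY2
      refine squeeze_zero_norm' ?_ hY2
      filter_upwards [eventually_gt_atTop σ, eventually_ge_atTop 1] with x hx hx1
      have hx0 : 0 < x := by linarith
      have hne : (x : ℂ) + 1 ≠ 0 := by
        exact_mod_cast (by linarith : x + 1 ≠ 0)
      have hYG : laplace y x = G x * (1 / (x + 1)) := by
        rw [(hrep e x (by simpa using hx)).2, laplace_congr (MemLp.coeFn_toLp _),
          laplace_exp_neg (by simpa using hx0)]
      have hGx : G x = laplace y x * (x + 1) := by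
        rw [hYG]
        field_simp
      rw [hGx, mul_assoc, norm_mul]
      gcongr
      rw [norm_mul, norm_div, norm_pow, norm_pow, Complex.norm_real, Real.norm_of_nonneg hx0.le,
        ← mul_div_assoc, div_le_iff₀ (by positivity)]
      have h1 : ‖(x : ℂ) + 1‖ ≤ 2 * x := by
        refine (norm_add_le _ _).trans ?_
        rw [Complex.norm_real, Real.norm_of_nonneg hx0.le, norm_one]
        linarith
      calc ‖(x : ℂ) + 1‖ * x ^ a.natDegree ≤ 2 * x * x ^ a.natDegree := by gcongr
        _ = 2 * x ^ (a.natDegree + 1) := by ring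
        _ ≤ 2 * x ^ b.natDegree := by
          gcongr
          exact hdeg
    exact div_ne_zero (leadingCoeff_ne_zero.2 hb) (leadingCoeff_ne_zero.2 ha)
      (tendsto_nhds_unique (hlim.comp hreal) h0)

/-- Normal form is what upgrades nonnegative order to analyticity: the values at removable
singularities are the right ones. -/
theorem analyticAt_of_stable {G : ℂ → ℂ} (hG : MeromorphicNFOn G univ)
    (hstable : ∀ p : ℂ, IsPole G p → p.re < 0) {s : ℂ} (hs : 0 ≤ s.re) : AnalyticAt ℂ G s := by
  rw [← (hG (mem_univ s)).meromorphicOrderAt_nonneg_iff_analyticAt]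
  by_contra h
  exact absurd (hstable s (not_le.1 h)) (not_lt.2 hs)

theorem IsProper.exists_bound {G : ℂ → ℂ} (hG : IsProper G)
    (hcont : ∀ s : ℂ, 0 ≤ s.re → ContinuousAt G s) :
    ∃ M : ℝ, ∀ s : ℂ, 0 ≤ s.re → ‖G s‖ ≤ M := by
  obtain ⟨ρ, M, hM⟩ := hG
  have hK : IsCompact (Metric.closedBall (0 : ℂ) ρ ∩ {s | 0 ≤ s.re}) :=
    (isCompact_closedBall 0 ρ).inter_right (isClosed_le continuous_const Complex.continuous_re)
  obtain ⟨M', hM'⟩ := hK.exists_bound_of_continuousOn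
    fun s hs => (hcont s hs.2).continuousWithinAt
  refine ⟨max M M', fun s hs => ?_⟩
  rcases le_total ρ ‖s‖ with h | h
  · exact (hM s hs h).trans (le_max_left _ _)
  · exact (hM' s ⟨by simpa using h, hs⟩).trans (le_max_right _ _)

theorem hInfNorm_le_iff {G : ℂ → ℂ} {M : ℝ} (hM : 0 ≤ M) :
    hInfNorm G ≤ ENNReal.ofReal M ↔ ∀ s : ℂ, 0 < s.re → ‖G s‖ ≤ M := by
  simp only [hInfNorm, iSup_le_iff, ENNReal.ofReal_le_ofReal_iff hM]

theorem radius_eq_iSup (C : Set ℂ) : radius C = ⨆ z ∈ C, ENNReal.ofReal ‖z‖ := by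
  apply le_antisymm
  · set S := ⨆ z ∈ C, ENNReal.ofReal ‖z‖ with hS
    -- The margin `ε` keeps the radius positive even when the supremum is `0`.
    refine ENNReal.le_of_forall_pos_le_add fun ε hε htop => ?_
    have hpos : 0 < S.toReal + ε := add_pos_of_nonneg_of_pos ENNReal.toReal_nonneg hε
    refine (iInf₂_le_of_le (S.toReal + ε) hpos (iInf_le_of_le (fun z hz => ?_) le_rfl)).trans_eq ?_
    · have : ENNReal.ofReal ‖z‖ ≤ S := le_iSup₂_of_le z hz le_rfl
      rw [mem_closedBall_zero_iff]
      have := (ENNReal.ofReal_le_iff_le_toReal htop.ne).1 this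
      linarith [ε.coe_nonneg]
    · rw [ENNReal.ofReal_add ENNReal.toReal_nonneg ε.coe_nonneg, ENNReal.ofReal_toReal htop.ne,
        ENNReal.ofReal_coe_nnreal]
  · refine le_iInf fun r => le_iInf fun _ => le_iInf fun h => iSup₂_le fun z hz => ?_
    exact ENNReal.ofReal_le_ofReal (mem_closedBall_zero_iff.1 (h hz))

/-- The maximum modulus principle: the `H_∞` norm is attained on the imaginary axis. -/
theorem radius_nyquist_eq_hInfNorm {G : ℂ → ℂ} (han : ∀ s : ℂ, 0 ≤ s.re → AnalyticAt ℂ G s) {M : ℝ}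
    (hM : ∀ s : ℂ, 0 ≤ s.re → ‖G s‖ ≤ M) : radius (nyquist G) = hInfNorm G := by
  rw [radius_eq_iSup, nyquist, iSup_range]
  apply le_antisymm
  · refine iSup_le fun ω => ?_
    have hlim : Tendsto (fun x : ℝ => ENNReal.ofReal ‖G (x + Complex.I * ω)‖) (𝓝[>] 0)
        (𝓝 (ENNReal.ofReal ‖G (Complex.I * ω)‖)) := by
      have h1 : Tendsto (fun x : ℝ => (x + Complex.I * ω : ℂ)) (𝓝[>] 0) (𝓝 (Complex.I * ω)) := by
        have : Continuous fun x : ℝ => (x + Complex.I * ω : ℂ) := by fun_prop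
        simpa using (this.tendsto 0).mono_left nhdsWithin_le_nhds
      exact ENNReal.tendsto_ofReal
        (((han (Complex.I * ω) (by simp)).continuousAt.tendsto.comp h1).norm)
    refine le_of_tendsto hlim ?_
    filter_upwards [self_mem_nhdsWithin] with x (hx : 0 < x)
    exact le_iSup₂_of_le (f := fun (s : ℂ) (_ : 0 < s.re) => ENNReal.ofReal ‖G s‖)
      (x + Complex.I * ω) (by simpa using hx) le_rfl
  · set S := ⨆ ω : ℝ, ENNReal.ofReal ‖G (Complex.I * ω)‖ with hS
    have hM0 : 0 ≤ M := (norm_nonneg _).trans (hM 0 (by simp))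
    have htop : S ≠ ∞ := ne_top_of_le_ne_top ENNReal.ofReal_ne_top
      (iSup_le fun ω => ENNReal.ofReal_le_ofReal (hM (Complex.I * ω) (by simp)))
    rw [← ENNReal.ofReal_toReal htop, hInfNorm_le_iff ENNReal.toReal_nonneg]
    intro s hs
    -- The growth hypotheses hold trivially, with exponent `1 < 2` and constant `0`, because `G` is
    -- already bounded by `M`; the gain is the sharp constant `S`.
    refine PhragmenLindelof.right_half_plane_of_bounded_on_real ?_ ?_ ?_ (fun ω => ?_) hs.le
    · refine ⟨fun s hs => (han s (le_of_lt hs)).differentiableAt.differentiableWithinAt, ?_⟩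
      rw [Complex.closure_setOfPred_lt_re]
      exact fun s hs => (han s hs).continuousAt.continuousWithinAt
    · refine ⟨1, one_lt_two, 0, Asymptotics.IsBigO.of_bound M ?_⟩
      filter_upwards [mem_inf_of_right (mem_principal_self _)] with z hz
      simpa using hM z (le_of_lt hz)
    · refine isBoundedUnder_of_eventually_le (a := M) ?_
      filter_upwards [eventually_ge_atTop 0] with x hx
      exact hM x (by simpa using hx)
    · rw [mul_comm]
      exact (ENNReal.ofReal_le_iff_le_toReal htop).1
        (le_iSup (fun ω : ℝ => ENNReal.ofReal ‖G (Complex.I * ω)‖) ω)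

/-- Once the output is known to be in `L₂`, both sides are analytic for `Re s > 0`, and the identity
theorem extends the relation from `Re s > σ`. -/
theorem laplace_eq_mul_of_re_pos {G : ℂ → ℂ} (hG : DifferentiableOn ℂ G {s | 0 < s.re})
    {u y : ℝ → ℝ} (hu : MemLp u 2 timeMeasure) (hy : MemLp y 2 timeMeasure) {σ : ℝ} (hσ : 0 ≤ σ)
    (h : ∀ s : ℂ, σ < s.re → laplace y s = G s * laplace u s) {s : ℂ} (hs : 0 < s.re) :
    laplace y s = G s * laplace u s := by
  refine ((differentiableOn_laplace hy).analyticOnNhd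
    isOpen_re_pos).eqOn_of_preconnected_of_eventuallyEq
    ((hG.mul (differentiableOn_laplace hu)).analyticOnNhd isOpen_re_pos)
    (convex_halfSpace_re_gt 0).isPreconnected (z₀ := ((σ + 1 : ℝ) : ℂ)) ?_ ?_ hs
  · change 0 < ((σ + 1 : ℝ) : ℂ).re
    rw [Complex.ofReal_re]
    linarith
  · filter_upwards [(isOpen_lt continuous_const Complex.continuous_re).mem_nhds
      (by simp : ((σ + 1 : ℝ) : ℂ) ∈ {s : ℂ | σ < s.re})] with z hz using h z hz

end TransferFunction

/-! ### Gains of linear operators -/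

section Gains

variable {H : Type*} [NormedAddCommGroup H] [InnerProductSpace ℝ H] {D : Set H}

theorem radius_srg_eq_incGain (R : D → H) : radius (srg R) = incGain R := by
  have hnorm : ∀ (u₁ u₂ : D) (θ : ℝ),
      ‖((‖R u₁ - R u₂‖ / ‖(u₁ : H) - u₂‖ : ℝ) : ℂ) * Complex.exp (Complex.I * θ)‖ =
        ‖R u₁ - R u₂‖ / ‖(u₁ : H) - u₂‖ := fun u₁ u₂ θ => by
    rw [norm_mul, Complex.norm_real, mul_comm Complex.I, Complex.norm_exp_ofReal_mul_I, mul_one,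
      Real.norm_of_nonneg (by positivity)]
  rw [radius_eq_iSup]
  apply le_antisymm
  · refine iSup₂_le ?_
    rintro z ⟨u₁, u₂, hne, θ, -, rfl⟩
    rw [hnorm]
    exact le_iSup_of_le u₁ (le_iSup₂_of_le u₂ hne le_rfl)
  · refine iSup_le fun u₁ => iSup₂_le fun u₂ hne => ?_
    refine le_iSup₂_of_le _ ⟨u₁, u₂, hne, _, Or.inl rfl, rfl⟩ ?_
    rw [hnorm]

theorem incGain_eq_gain_of_linear {R : D → H} (T : H →L[ℝ] H) (hD : D = univ)
    (hR : ∀ u : D, R u = T u) : incGain R = gain R := by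
  subst hD
  apply le_antisymm
  · refine iSup_le fun u₁ => iSup₂_le fun u₂ hne => ?_
    refine le_iSup₂_of_le ⟨(u₁ : H) - u₂, mem_univ _⟩
      (sub_ne_zero.2 fun h => hne (Subtype.ext h)) ?_
    rw [hR, hR, hR, map_sub]
  · refine iSup₂_le fun u hu => ?_
    -- Comparing with the zero input turns a gain quotient into an incremental one.
    refine le_iSup_of_le u (le_iSup₂_of_le ⟨0, mem_univ _⟩ (fun h => hu (by rw [h])) ?_)
    rw [hR, hR, map_zero, sub_zero, sub_zero]

end Gains

theorem gain_le_iff {H : Type*} [NormedAddCommGroup H] {D : Set H} {R : D → H} {γ : ℝ} (hγ : 0 ≤ γ) :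
    gain R ≤ ENNReal.ofReal γ ↔ ∀ u : D, (u : H) ≠ 0 → ‖R u‖ ≤ γ * ‖(u : H)‖ := by
  simp only [gain, iSup_le_iff, ENNReal.ofReal_le_ofReal_iff hγ]
  refine forall₂_congr fun u hu => ?_
  rw [div_le_iff₀ (norm_pos_iff.2 hu)]


end SRG

/-! ### Assembly of the equalities -/

theorem mainTheorem6 (R : SRG.L2e → SRG.L2e) (hR : SRG.IsLTI R)
    (G : ℂ → ℂ) (hG : SRG.IsTransferFunction G R)
    (hstable : ∀ p : ℂ, SRG.IsPole G p → p.re < 0)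
    (hclass : SRG.IsRational G ∨ SRG.IsProper G) :
    SRG.IsL2Stable R ∧
    SRG.radius (SRG.srg (SRG.onL2 R)) = SRG.radius (SRG.nyquist G) ∧
    SRG.radius (SRG.nyquist G) = SRG.incGain (SRG.onL2 R) ∧
    SRG.incGain (SRG.onL2 R) = SRG.gain (SRG.onL2 R) ∧
    SRG.gain (SRG.onL2 R) = SRG.hInfNorm G := by
  have han : ∀ s : ℂ, 0 ≤ s.re → AnalyticAt ℂ G s := fun s hs =>
    SRG.analyticAt_of_stable hG.meromorphic hstable hs
  have hproper : SRG.IsProper G := hclass.elim (fun h => h.isProper hG.represents) id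
  obtain ⟨M₀, hM₀⟩ := hproper.exists_bound fun s hs => (han s hs).continuousAt
  have hGd : DifferentiableOn ℂ G {s | 0 < s.re} := fun s hs =>
    (han s (le_of_lt hs)).differentiableAt.differentiableWithinAt
  have hM₀0 : 0 ≤ M₀ := (norm_nonneg _).trans (hM₀ 0 (by simp))
  have htop : SRG.hInfNorm G ≠ ∞ := ne_top_of_le_ne_top ENNReal.ofReal_ne_top
    ((SRG.hInfNorm_le_iff hM₀0).2 fun s hs => hM₀ s hs.le)
  -- The crude bound `M₀` serves only for finiteness; the operator is built with the sharp bound,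
  -- the `H_∞` norm itself.
  obtain ⟨T, hT, hTM⟩ := SRG.exists_clm_of_represents hR.linear hG.represents hGd
    ((SRG.hInfNorm_le_iff ENNReal.toReal_nonneg).1 (ENNReal.ofReal_toReal htop).ge)
  have hdom : SRG.domL2 R = univ := eq_univ_of_forall fun u => by
    change (R u.toL2e).1 ∈ Lp ℝ 2 SRG.timeMeasure
    rw [hT u]
    exact (T u).2
  have hon : ∀ u : SRG.domL2 R, SRG.onL2 R u = T u := fun u => Subtype.ext (hT u)
  have hgain : SRG.gain (SRG.onL2 R) = SRG.hInfNorm G := by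
    have hle : SRG.gain (SRG.onL2 R) ≤ SRG.hInfNorm G := by
      rw [← ENNReal.ofReal_toReal htop, SRG.gain_le_iff ENNReal.toReal_nonneg]
      intro u _
      rw [hon]
      exact hTM u
    refine le_antisymm hle ?_
    have hgtop := ne_top_of_le_ne_top htop hle
    rw [← ENNReal.ofReal_toReal hgtop, SRG.hInfNorm_le_iff ENNReal.toReal_nonneg]
    intro s hs
    refine SRG.norm_le_of_laplace_eq_mul (T := T) hs (fun u => ?_) fun u => ?_
    · obtain ⟨σ, hσ, hrep⟩ := hG.represents
      refine SRG.laplace_eq_mul_of_re_pos hGd (Lp.memLp u) (Lp.memLp (T u)) hσ (fun z hz => ?_) hs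
      rw [← (hrep u z hz).2, hT u]
    · rcases eq_or_ne u 0 with rfl | hu
      · simp
      · have := (SRG.gain_le_iff ENNReal.toReal_nonneg).1 (ENNReal.ofReal_toReal hgtop).ge
          ⟨u, hdom ▸ mem_univ u⟩ hu
        rwa [hon] at this
  have hinc : SRG.incGain (SRG.onL2 R) = SRG.gain (SRG.onL2 R) :=
    SRG.incGain_eq_gain_of_linear T hdom hon
  have hnyq := SRG.radius_nyquist_eq_hInfNorm han hM₀
  refine ⟨hdom, ?_, ?_, hinc, hgain⟩
  · rw [SRG.radius_srg_eq_incGain, hinc, hgain, hnyq]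
  · rw [hnyq, hinc, hgain]
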